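/- Let $V=\mathbb{C}^2$ and let $G$ be a finite subgroup of $\mathrm{GL}_2(\mathbb{C})$ generated by the reflections it contains, where $s\in\mathrm{GL}_2(\mathbb{C})$ is a \emph{reflection} if its fixed subspace $V^s=\{v\in V : s(v)=v\}$ has dimension $1$. Let $\Gamma$ be a subgroup of $G$ of index $1$ or $2$, let $V/\Gamma=\operatorname{Spec}\,\mathbb{C}[V]^{\Gamma}$ be the quotient variety, where $\Gamma$ acts on the algebra $\mathbb{C}[V]$ of polynomial functions on $V$ by $(g\cdot f)(v)=f(g^{-1}v)$, and let $\bar 0\in V/\Gamma$ be the image of $0\in V$. Then $\bar 0$ is either a smooth point of $V/\Gamma$ or an ADE singularity of $V/\Gamma$. Here $\bar 0$ is called an \emph{ADE singularity} if the completion of the local ring of $V/\Gamma$ at $\bar 0$ is isomorphic, as a $\mathbb{C}$-algebra, to $\mathbb{C}[[t,u]]^{H}$ for some nontrivial finite subgroup $H$ of $\mathrm{SL}_2(\mathbb{C})$ acting on $\mathbb{C}[[t,u]]$ by linear changes of the variables. -/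

import Mathlib

open Matrix

noncomputable section

namespace PlaneQuotient

/-- The fixed subspace `V^s = {v | s v = v}` of `s ∈ GL₂(ℂ)` acting on `V = ℂ²`. -/
def fixedSpace (s : GL (Fin 2) ℂ) : Submodule ℂ (Fin 2 → ℂ) where
  carrier := {v | s.1 *ᵥ v = v}
  add_mem' {v w} hv hw := by
    simp only [Set.mem_ofPred_eq] at hv hw ⊢
    rw [Matrix.mulVec_add, hv, hw]
  zero_mem' := by simp
  smul_mem' c v hv := by
    simp only [Set.mem_ofPred_eq] at hv ⊢
    rw [Matrix.mulVec_smul, hv]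

/-- A (complex) reflection of `V = ℂ²`: the fixed subspace is a hyperplane, i.e. a line. -/
def IsReflection (s : GL (Fin 2) ℂ) : Prop :=
  Module.finrank ℂ (fixedSpace s) = 1

/-- The set of reflections contained in `G`. -/
def reflections (G : Subgroup (GL (Fin 2) ℂ)) : Set (GL (Fin 2) ℂ) :=
  {s | s ∈ G ∧ IsReflection s}

/-- The action of `g` on polynomial functions on `ℂ²`, `(g f)(v) = f(g⁻¹ v)`: it sends the
coordinate `Xᵢ` to the linear form `∑ⱼ (g⁻¹)ᵢⱼ Xⱼ`. -/
def polyAct (g : GL (Fin 2) ℂ) : MvPolynomial (Fin 2) ℂ →ₐ[ℂ] MvPolynomial (Fin 2) ℂ :=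
  MvPolynomial.aeval fun i => ∑ j, MvPolynomial.C ((g⁻¹).1 i j) * MvPolynomial.X j

/-- The ring of invariants `ℂ[V]^Γ`. For finite `Γ` it is the coordinate ring of the affine
quotient variety `V/Γ = ℂ²/Γ`. -/
def polyInvariants (Γ : Subgroup (GL (Fin 2) ℂ)) :
    Subalgebra ℂ (MvPolynomial (Fin 2) ℂ) where
  carrier := {f | ∀ g ∈ Γ, polyAct g f = f}
  mul_mem' {a b} ha hb g hg := by rw [map_mul, ha g hg, hb g hg]
  add_mem' {a b} ha hb g hg := by rw [map_add, ha g hg, hb g hg]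
  algebraMap_mem' r g _ := by rw [AlgHom.commutes]

/-- The quotient map `ℂ² → ℂ²/Γ`: it is dual to the inclusion `ℂ[V]^Γ ⊆ ℂ[V]`, and a vector is
identified with the prime ideal of the polynomials vanishing at it. -/
def quotientMap (Γ : Subgroup (GL (Fin 2) ℂ)) (v : Fin 2 → ℂ) :
    PrimeSpectrum (polyInvariants Γ) :=
  PrimeSpectrum.comap (polyInvariants Γ).val.toRingHom
    (MvPolynomial.pointToPoint (k := ℂ) v)

lemma hasSubst_linear (A : Matrix (Fin 2) (Fin 2) ℂ) :
    MvPowerSeries.HasSubst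
      (fun i => ∑ j, MvPowerSeries.C (A i j) * MvPowerSeries.X j :
        Fin 2 → MvPowerSeries (Fin 2) ℂ) :=
  MvPowerSeries.hasSubst_of_constantCoeff_zero fun i => by simp

/-- The action of `g` on `ℂ⟦t, u⟧` by the same linear change of the variables. -/
def seriesAct (g : GL (Fin 2) ℂ) : MvPowerSeries (Fin 2) ℂ →ₐ[ℂ] MvPowerSeries (Fin 2) ℂ :=
  MvPowerSeries.substAlgHom (hasSubst_linear (g⁻¹).1)

/-- The ring of invariants `ℂ⟦t, u⟧^H`. -/
def seriesInvariants (H : Subgroup (GL (Fin 2) ℂ)) :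
    Subalgebra ℂ (MvPowerSeries (Fin 2) ℂ) where
  carrier := {f | ∀ g ∈ H, seriesAct g f = f}
  mul_mem' {a b} ha hb g hg := by rw [map_mul, ha g hg, hb g hg]
  add_mem' {a b} ha hb g hg := by rw [map_add, ha g hg, hb g hg]
  algebraMap_mem' r g _ := by rw [AlgHom.commutes]

/-- The completed local ring of `Spec A` at the point `x`. -/
abbrev CompletedLocalRing (A : Type*) [CommRing A] (x : PrimeSpectrum A) : Type _ :=
  AdicCompletion (IsLocalRing.maximalIdeal (Localization.AtPrime x.asIdeal))
    (Localization.AtPrime x.asIdeal)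

/-- A point `x` of the affine complex variety `Spec A` is an ADE (simple, Du Val) surface
singularity: its completed local ring is isomorphic to `ℂ⟦t, u⟧^H` for a nontrivial finite
subgroup `H` of `SL₂(ℂ)`. -/
def IsADESingularity (A : Type*) [CommRing A] [Algebra ℂ A] (x : PrimeSpectrum A) : Prop :=
  ∃ H : Subgroup (SpecialLinearGroup (Fin 2) ℂ), Finite H ∧ H ≠ ⊥ ∧
    Nonempty (CompletedLocalRing A x ≃ₐ[ℂ]
      seriesInvariants (H.map SpecialLinearGroup.toGL))

/-- A point `x` of the affine complex variety `Spec A` is smooth (over `ℂ`). -/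
def IsSmoothPoint (A : Type*) [CommRing A] [Algebra ℂ A] (x : PrimeSpectrum A) : Prop :=
  x ∈ Algebra.smoothLocus ℂ A

end PlaneQuotient

end

/-!
Let `R` be the subgroup generated by the reflections contained in `Γ`; it is normal in `G`.

By the theorem of Chevalley–Shephard–Todd (`exists_isHilbertSystem_fin_two`, proved
here for the plane along the lines of Chevalley's argument), `ℂ[V]^R` is a polynomial ring
`ℂ[f₀, f₁]` in two homogeneous invariants, so that `V/R` is again a plane. If `Γ = R`, which
includes the case `Γ = G`, the quotient `V/Γ` is therefore smooth.

Otherwise `Γ` has index two in `G`. The generators can be chosen such that `G` acts linearly on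
their span (`exists_isHilbertSystem_equivariant`). This gives a representation `ρ` of `G` on the
plane `V/R`, with kernel `R`, and identifies `ℂ[V]^Γ` with the invariants of the finite linear group
`ρ(Γ) ≅ Γ/R ≠ 1`. The essential point is that `ρ(Γ) ⊆ SL₂(ℂ)`
(`det_monoidHom_eq_one_of_mem`). A reflection `s ∈ Γ` acts trivially on `V/R`. For a reflection
`s ∈ G` outside `Γ`, the square `s²` is the identity or a reflection in `Γ`, so `ρ(s)` is a
nontrivial involution; it fixes the image of a nonzero vector of `V^s`, which is not the origin, and
so `det ρ(s) = -1`. As `G` is generated by reflections, `det ρ` is the character of `G` of order two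
with kernel `Γ`.

It remains to see that the completed local ring of `ℂ[t, u]^H` at the origin is `ℂ⟦t, u⟧^H` for a
finite linear group `H` (`nonempty_completedLocalRing_algEquiv_seriesInvariants`): truncations of
invariant series are invariant polynomials, and invariants of large degree lie in a high power of
the maximal ideal.
-/

/-! ### The action on polynomial functions -/

namespace PlaneQuotient

open MvPolynomial

noncomputable section

lemma polyAct_X (g : GL (Fin 2) ℂ) (i : Fin 2) :
    polyAct g (X i) = ∑ j, C ((g⁻¹).1 i j) * X j := by
  simp [polyAct]

lemma polyAct_C (g : GL (Fin 2) ℂ) (c : ℂ) : polyAct g (C c) = C c := by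
  simp [polyAct]

lemma polyAct_mul (g h : GL (Fin 2) ℂ) (p : MvPolynomial (Fin 2) ℂ) :
    polyAct (g * h) p = polyAct g (polyAct h p) := by
  suffices polyAct (g * h) = (polyAct g).comp (polyAct h) by rw [this]; rfl
  refine MvPolynomial.algHom_ext fun i => ?_
  simp only [AlgHom.comp_apply, polyAct_X, map_sum, map_mul, polyAct_C,
    show ((g * h)⁻¹).1 = (h⁻¹).1 * (g⁻¹).1 by rw [_root_.mul_inv_rev, Units.val_mul],
    Matrix.mul_apply, map_sum, map_mul, Finset.sum_mul, Finset.mul_sum]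
  rw [Finset.sum_comm]
  simp only [mul_assoc]

@[simp] lemma polyAct_one (p : MvPolynomial (Fin 2) ℂ) : polyAct 1 p = p := by
  suffices polyAct 1 = AlgHom.id ℂ _ by rw [this]; rfl
  refine MvPolynomial.algHom_ext fun i => ?_
  fin_cases i <;> simp [polyAct_X, Fin.sum_univ_two]

lemma polyAct_inv_polyAct (g : GL (Fin 2) ℂ) (p : MvPolynomial (Fin 2) ℂ) :
    polyAct g⁻¹ (polyAct g p) = p := by
  rw [← polyAct_mul, inv_mul_cancel, polyAct_one]

lemma eval_polyAct (g : GL (Fin 2) ℂ) (v : Fin 2 → ℂ) (p : MvPolynomial (Fin 2) ℂ) :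
    eval v (polyAct g p) = eval ((g⁻¹).1 *ᵥ v) p := by
  suffices (aeval (R := ℂ) v).comp (polyAct g) = aeval (R := ℂ) ((g⁻¹).1 *ᵥ v) by
    have := DFunLike.congr_fun this p
    simpa [aeval_eq_eval] using this
  refine MvPolynomial.algHom_ext fun i => ?_
  simp only [AlgHom.comp_apply, polyAct_X, map_sum, map_mul, aeval_X, algHom_C, Matrix.mulVec,
    dotProduct, Algebra.algebraMap_self, RingHom.id_apply]

lemma isHomogeneous_polyAct {p : MvPolynomial (Fin 2) ℂ} {n : ℕ} (hp : p.IsHomogeneous n)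
    (g : GL (Fin 2) ℂ) : (polyAct g p).IsHomogeneous n := by
  have := hp.aeval (n := 1) (fun i => ∑ j, C ((g⁻¹).1 i j) * X j : Fin 2 → MvPolynomial (Fin 2) ℂ)
    fun i => IsHomogeneous.sum _ _ _ fun j _ => isHomogeneous_C_mul_X _ _
  rwa [one_mul] at this

lemma homogeneousComponent_polyAct (g : GL (Fin 2) ℂ) (n : ℕ) (p : MvPolynomial (Fin 2) ℂ) :
    homogeneousComponent n (polyAct g p) = polyAct g (homogeneousComponent n p) := by
  conv_lhs => rw [← sum_homogeneousComponent p, map_sum, map_sum]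
  rw [Finset.sum_eq_single n]
  · exact homogeneousComponent_eq_self
      (isHomogeneous_polyAct (homogeneousComponent_isHomogeneous n p) g)
  · intro m _ hm
    rw [homogeneousComponent_of_mem
      (isHomogeneous_polyAct (homogeneousComponent_isHomogeneous m p) g), if_neg hm.symm]
  · intro hn
    have h0 : homogeneousComponent n p = 0 := homogeneousComponent_eq_zero _ _ (by simpa using hn)
    rw [h0, map_zero, map_zero]

@[simp] lemma constantCoeff_polyAct (g : GL (Fin 2) ℂ) (p : MvPolynomial (Fin 2) ℂ) :
    constantCoeff (polyAct g p) = constantCoeff p := by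
  have := homogeneousComponent_polyAct g 0 p
  rw [homogeneousComponent_zero, homogeneousComponent_zero, polyAct_C] at this
  exact C_injective _ _ this

lemma totalDegree_polyAct_le (g : GL (Fin 2) ℂ) (p : MvPolynomial (Fin 2) ℂ) :
    (polyAct g p).totalDegree ≤ p.totalDegree := by
  conv_lhs => rw [← sum_homogeneousComponent p, map_sum]
  refine (totalDegree_finsetSum _ _).trans (Finset.sup_le fun n hn => ?_)
  refine (IsHomogeneous.totalDegree_le
    (isHomogeneous_polyAct (homogeneousComponent_isHomogeneous n p) g)).trans ?_
  simpa using Nat.lt_succ_iff.mp (Finset.mem_range.mp hn)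

lemma mem_polyInvariants {Γ : Subgroup (GL (Fin 2) ℂ)} {p : MvPolynomial (Fin 2) ℂ} :
    p ∈ polyInvariants Γ ↔ ∀ g ∈ Γ, polyAct g p = p := Iff.rfl

lemma homogeneousComponent_mem_polyInvariants {Γ : Subgroup (GL (Fin 2) ℂ)}
    {p : MvPolynomial (Fin 2) ℂ} (hp : p ∈ polyInvariants Γ) (n : ℕ) :
    homogeneousComponent n p ∈ polyInvariants Γ := fun g hg => by
  rw [← homogeneousComponent_polyAct, hp g hg]

/-! ### The Reynolds operator -/

/-- The Reynolds operator of a finite group: averaging a polynomial over its translates. -/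
def reynolds (R : Subgroup (GL (Fin 2) ℂ)) [Fintype R] :
    MvPolynomial (Fin 2) ℂ →ₗ[ℂ] MvPolynomial (Fin 2) ℂ :=
  (Fintype.card R : ℂ)⁻¹ • ∑ g : R, (polyAct g.1).toLinearMap

section

variable {R : Subgroup (GL (Fin 2) ℂ)} [Fintype R]

lemma reynolds_apply (p : MvPolynomial (Fin 2) ℂ) :
    reynolds R p = (Fintype.card R : ℂ)⁻¹ • ∑ g : R, polyAct g.1 p := by
  simp [reynolds]

lemma card_inv_smul_sum_const (p : MvPolynomial (Fin 2) ℂ) :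
    (Fintype.card R : ℂ)⁻¹ • ∑ _g : R, p = p := by
  rw [Finset.sum_const, Finset.card_univ, ← Nat.cast_smul_eq_nsmul ℂ, smul_smul,
    inv_mul_cancel₀ (by exact_mod_cast Fintype.card_ne_zero), one_smul]

lemma reynolds_mem (p : MvPolynomial (Fin 2) ℂ) : reynolds R p ∈ polyInvariants R := by
  refine mem_polyInvariants.mpr fun g hg => ?_
  rw [reynolds_apply, map_smul, map_sum]
  refine congrArg _ ?_
  refine Fintype.sum_equiv (Equiv.mulLeft (⟨g, hg⟩ : R)) _ _ fun h => ?_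
  rw [← polyAct_mul, Equiv.coe_mulLeft, Subgroup.coe_mul]

lemma reynolds_mul {b : MvPolynomial (Fin 2) ℂ} (hb : b ∈ polyInvariants R)
    (p : MvPolynomial (Fin 2) ℂ) : reynolds R (p * b) = reynolds R p * b := by
  rw [reynolds_apply, reynolds_apply, smul_mul_assoc, Finset.sum_mul]
  congr 1
  exact Finset.sum_congr rfl fun g _ => by rw [map_mul, hb g.1 g.2]

lemma reynolds_eq_self {b : MvPolynomial (Fin 2) ℂ} (hb : b ∈ polyInvariants R) :
    reynolds R b = b := by
  rw [reynolds_apply, Finset.sum_congr rfl fun g _ => hb g.1 g.2, card_inv_smul_sum_const]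

lemma isHomogeneous_reynolds {p : MvPolynomial (Fin 2) ℂ} {n : ℕ} (hp : p.IsHomogeneous n) :
    (reynolds R p).IsHomogeneous n := by
  rw [reynolds_apply, smul_eq_C_mul]
  exact (IsHomogeneous.sum _ _ _ fun g _ => isHomogeneous_polyAct hp g.1).C_mul _

/-- If every translate of `p` is congruent to `p` modulo an ideal, so is the average. -/
lemma sub_reynolds_mem {I : Ideal (MvPolynomial (Fin 2) ℂ)} {p : MvPolynomial (Fin 2) ℂ}
    (h : ∀ g ∈ R, p - polyAct g p ∈ I) : p - reynolds R p ∈ I := by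
  have : p - reynolds R p = (Fintype.card R : ℂ)⁻¹ • ∑ g : R, (p - polyAct g.1 p) := by
    rw [Finset.sum_sub_distrib, smul_sub, card_inv_smul_sum_const, reynolds_apply]
  rw [this, smul_eq_C_mul]
  exact I.mul_mem_left _ (I.sum_mem fun g _ => h g.1 g.2)

end

/-! ### Generators of the ideal of positive-degree invariants -/

/-- The Hilbert ideal: the ideal of `ℂ[V]` generated by the homogeneous invariants of positive
degree. -/
def hilbertIdeal (R : Subgroup (GL (Fin 2) ℂ)) : Ideal (MvPolynomial (Fin 2) ℂ) :=
  Ideal.span {f | f ∈ polyInvariants R ∧ ∃ d, 0 < d ∧ f.IsHomogeneous d}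

/-- A family of homogeneous invariants of positive degrees generating the Hilbert ideal. -/
structure IsHilbertSystem (R : Subgroup (GL (Fin 2) ℂ)) {ι : Type*}
    (f : ι → MvPolynomial (Fin 2) ℂ) (d : ι → ℕ) : Prop where
  mem : ∀ i, f i ∈ polyInvariants R
  pos : ∀ i, 0 < d i
  homogeneous : ∀ i, (f i).IsHomogeneous (d i)
  span : Ideal.span (Set.range f) = hilbertIdeal R

section

variable {R : Subgroup (GL (Fin 2) ℂ)}

lemma sub_C_constantCoeff (b : MvPolynomial (Fin 2) ℂ) :
    b - C (constantCoeff b) = ∑ n ∈ Finset.range b.totalDegree, homogeneousComponent (n + 1) b := by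
  rw [sub_eq_iff_eq_add, constantCoeff_eq, ← homogeneousComponent_zero,
    ← Finset.sum_range_succ' (fun n => homogeneousComponent n b), sum_homogeneousComponent]

lemma mem_hilbertIdeal_of_isHomogeneous {b : MvPolynomial (Fin 2) ℂ} (hb : b ∈ polyInvariants R)
    {d : ℕ} (hd : 0 < d) (h : b.IsHomogeneous d) : b ∈ hilbertIdeal R :=
  Ideal.subset_span ⟨hb, d, hd, h⟩

lemma mem_hilbertIdeal {b : MvPolynomial (Fin 2) ℂ} (hb : b ∈ polyInvariants R)
    (h0 : constantCoeff b = 0) : b ∈ hilbertIdeal R := by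
  have := sub_C_constantCoeff b
  rw [h0, map_zero, sub_zero] at this
  rw [this]
  exact Ideal.sum_mem _ fun n _ => mem_hilbertIdeal_of_isHomogeneous
    (homogeneousComponent_mem_polyInvariants hb _) n.succ_pos
    (homogeneousComponent_isHomogeneous _ _)

lemma polyAct_mem_hilbertIdeal {p : MvPolynomial (Fin 2) ℂ} (hp : p ∈ hilbertIdeal R)
    {g : GL (Fin 2) ℂ} (hg : g ∈ R) : polyAct g p ∈ hilbertIdeal R := by
  suffices hilbertIdeal R ≤ (hilbertIdeal R).comap (polyAct g) from this hp
  refine Ideal.span_le.mpr fun f hf => ?_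
  change polyAct g f ∈ hilbertIdeal R
  rw [hf.1 g hg]
  exact Ideal.subset_span hf

lemma constantCoeff_eq_zero_of_isHomogeneous {f : MvPolynomial (Fin 2) ℂ} {d : ℕ} (hd : 0 < d)
    (hf : f.IsHomogeneous d) : constantCoeff f = 0 := by
  rw [constantCoeff_eq]
  exact hf.coeff_eq_zero (by simpa using hd.ne)

end

lemma homogeneousComponent_mul_of_isHomogeneous {f : MvPolynomial (Fin 2) ℂ} {d : ℕ}
    (hf : f.IsHomogeneous d) (c : MvPolynomial (Fin 2) ℂ) (n : ℕ) :
    homogeneousComponent n (c * f) =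
      if d ≤ n then homogeneousComponent (n - d) c * f else 0 := by
  have hterm : ∀ m, homogeneousComponent n (homogeneousComponent m c * f) =
      if n = m + d then homogeneousComponent m c * f else 0 := fun m =>
    homogeneousComponent_of_mem ((homogeneousComponent_isHomogeneous m c).mul hf)
  conv_lhs => rw [← sum_homogeneousComponent c, Finset.sum_mul, map_sum]
  simp only [hterm]
  split_ifs with h
  · rw [Finset.sum_eq_single (n - d)]
    · rw [if_pos (by omega)]
    · intro m _ hm
      rw [if_neg (by omega)]
    · intro hn
      have h0 : homogeneousComponent (n - d) c = 0 :=
        homogeneousComponent_eq_zero _ _ (by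
          have := Finset.mem_range.not.mp hn
          omega)
      rw [h0, zero_mul, ite_self]
  · exact Finset.sum_eq_zero fun m _ => if_neg (by omega)

/-- The maximal ideal of the origin consists of the invariants without constant term. -/
lemma mem_quotientMap_zero {Γ : Subgroup (GL (Fin 2) ℂ)} {b : polyInvariants Γ} :
    b ∈ (quotientMap Γ 0).asIdeal ↔ constantCoeff b.1 = 0 := by
  change b.1 ∈ MvPolynomial.vanishingIdeal ℂ {(0 : Fin 2 → ℂ)} ↔ _
  simp [aeval_eq_eval, constantCoeff_eq, eval_zero]

section

variable {R : Subgroup (GL (Fin 2) ℂ)}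

/-- A homogeneous invariant of positive degree is a combination of the members of a Hilbert system
with homogeneous invariant coefficients of the expected degrees. -/
lemma IsHilbertSystem.exists_eq_sum [Finite R] {ι : Type*} [Fintype ι]
    {f : ι → MvPolynomial (Fin 2) ℂ}
    {d : ι → ℕ} (hf : IsHilbertSystem R f d) {b : MvPolynomial (Fin 2) ℂ}
    (hb : b ∈ polyInvariants R) {n : ℕ} (hn : 0 < n) (h : b.IsHomogeneous n) :
    ∃ a : ι → MvPolynomial (Fin 2) ℂ, (∀ i, a i ∈ polyInvariants R) ∧
      (∀ i, (a i).IsHomogeneous (n - d i)) ∧ (∀ i, n < d i → a i = 0) ∧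
      b = ∑ i, a i * f i := by
  have := Fintype.ofFinite R
  have hbI := mem_hilbertIdeal_of_isHomogeneous hb hn h
  rw [← hf.span] at hbI
  obtain ⟨c, hc⟩ := Ideal.mem_span_range_iff_exists_fun.mp hbI
  refine ⟨fun i => if d i ≤ n then reynolds R (homogeneousComponent (n - d i) (c i)) else 0,
    fun i => ?_, fun i => ?_, fun i hi => if_neg (by omega), ?_⟩
  · dsimp only
    split_ifs
    exacts [reynolds_mem _, zero_mem _]
  · dsimp only
    split_ifs
    exacts [isHomogeneous_reynolds (homogeneousComponent_isHomogeneous _ _),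
      isHomogeneous_zero _ _ _]
  · have h1 : b = reynolds R (homogeneousComponent n b) := by
      rw [homogeneousComponent_eq_self h, reynolds_eq_self hb]
    conv_lhs => rw [h1, ← hc, map_sum, map_sum]
    refine Finset.sum_congr rfl fun i _ => ?_
    rw [homogeneousComponent_mul_of_isHomogeneous (hf.homogeneous i)]
    dsimp only
    split_ifs
    · rw [reynolds_mul (hf.mem i)]
    · rw [map_zero, zero_mul]

/-- Hilbert's theorem: generators of the Hilbert ideal generate the algebra of invariants. -/
lemma IsHilbertSystem.adjoin_eq [Finite R] {ι : Type*} [Fintype ι]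
    {f : ι → MvPolynomial (Fin 2) ℂ}
    {d : ι → ℕ} (hf : IsHilbertSystem R f d) :
    Algebra.adjoin ℂ (Set.range f) = polyInvariants R := by
  refine le_antisymm (Algebra.adjoin_le ?_) ?_
  · rintro _ ⟨i, rfl⟩
    exact hf.mem i
  have key : ∀ n, ∀ b ∈ polyInvariants R, b.IsHomogeneous n →
      b ∈ Algebra.adjoin ℂ (Set.range f) := by
    intro n
    induction n using Nat.strong_induction_on with
    | _ n ih =>
      intro b hb h
      rcases Nat.eq_zero_or_pos n with rfl | hn
      · rw [← homogeneousComponent_eq_self h, homogeneousComponent_zero]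
        exact Subalgebra.algebraMap_mem _ _
      · obtain ⟨a, ha, hah, -, rfl⟩ := hf.exists_eq_sum hb hn h
        refine Subalgebra.sum_mem _ fun i _ => Subalgebra.mul_mem _ ?_
          (Algebra.subset_adjoin (Set.mem_range_self i))
        exact ih _ (Nat.sub_lt hn (hf.pos i)) _ (ha i) (hah i)
  intro b hb
  rw [← sum_homogeneousComponent b]
  exact Subalgebra.sum_mem _ fun n _ => key n _ (homogeneousComponent_mem_polyInvariants hb n)
    (homogeneousComponent_isHomogeneous n b)

/-- Invariants of large degree lie in a high power of the maximal ideal of the origin, because the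
degrees of the generators are bounded. -/
lemma IsHilbertSystem.mem_pow_of_isHomogeneous [Finite R] {ι : Type*} [Fintype ι]
    {f : ι → MvPolynomial (Fin 2) ℂ} {d : ι → ℕ} (hf : IsHilbertSystem R f d) {D : ℕ}
    (hD : ∀ i, d i ≤ D) (hD0 : 0 < D) (N : ℕ) (b : polyInvariants R) {n : ℕ}
    (hb : b.1.IsHomogeneous n) (hn : N * D ≤ n) :
    b ∈ (quotientMap R 0).asIdeal ^ N := by
  induction N generalizing n b with
  | zero => simp
  | succ N ih =>
    have hn' : N * D + D ≤ n := by rwa [Nat.succ_mul] at hn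
    obtain ⟨a, ha, hah, ha0, hsum⟩ := hf.exists_eq_sum b.2 (by omega) hb
    have : b = ∑ i, (⟨a i, ha i⟩ : polyInvariants R) * ⟨f i, hf.mem i⟩ := by
      ext1
      simpa using hsum
    rw [this]
    refine Ideal.sum_mem _ fun i _ => ?_
    rw [pow_succ]
    refine Ideal.mul_mem_mul (ih _ (hah i) ?_) ?_
    · have := hD i
      omega
    · rw [mem_quotientMap_zero]
      exact constantCoeff_eq_zero_of_isHomogeneous (hf.pos i) (hf.homogeneous i)

/-- There is a finite Hilbert system, none of whose members lies in the ideal generated by the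
others. -/
lemma exists_isHilbertSystem (R : Subgroup (GL (Fin 2) ℂ)) :
    ∃ (t : Finset (MvPolynomial (Fin 2) ℂ)) (d : t → ℕ),
      IsHilbertSystem R (Subtype.val : t → MvPolynomial (Fin 2) ℂ) d ∧
      ∀ i : t, i.1 ∉ Ideal.span ((Subtype.val : t → MvPolynomial (Fin 2) ℂ) '' {i}ᶜ) := by
  classical
  have hex : ∃ n, ∃ t : Finset (MvPolynomial (Fin 2) ℂ), t.card = n ∧
      (t : Set (MvPolynomial (Fin 2) ℂ)) ⊆
        {f | f ∈ polyInvariants R ∧ ∃ d, 0 < d ∧ f.IsHomogeneous d} ∧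
      Ideal.span t = hilbertIdeal R := by
    obtain ⟨t, ht, hspan⟩ := Submodule.fg_span_iff_fg_span_finset_subset _ |>.mp
      (IsNoetherian.noetherian (hilbertIdeal R))
    exact ⟨_, t, rfl, ht, hspan.symm⟩
  obtain ⟨t, htn, ht, hspan⟩ := Nat.find_spec hex
  choose d hd0 hd using fun i : t => (ht i.2).2
  refine ⟨t, d, ⟨fun i => (ht i.2).1, hd0, hd, by rw [← hspan, Subtype.range_coe]⟩,
    fun i hi => ?_⟩
  have himg : ((Subtype.val : t → MvPolynomial (Fin 2) ℂ) '' {i}ᶜ) = (t.erase i.1 : Finset _) := by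
    ext x
    simp only [Set.mem_image, Set.mem_compl_iff, Set.mem_singleton_iff, Subtype.exists,
      exists_and_right, exists_eq_right, Finset.coe_erase, Set.mem_sdiff, Finset.mem_coe]
    constructor
    · rintro ⟨hx, hne⟩
      exact ⟨hx, fun h => hne (Subtype.ext h)⟩
    · rintro ⟨hx, hne⟩
      exact ⟨hx, fun h => hne (congrArg Subtype.val h)⟩
  rw [himg] at hi
  refine Nat.find_min hex (m := (t.erase i.1).card) ?_
    ⟨t.erase i.1, rfl, fun x hx => ht (Finset.mem_of_mem_erase hx), ?_⟩
  · rw [← htn]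
    exact Finset.card_erase_lt_of_mem i.2
  · rw [← hspan]
    refine le_antisymm (Ideal.span_mono (Finset.coe_subset.mpr (Finset.erase_subset _ _)))
      (Ideal.span_le.mpr fun x hx => ?_)
    by_cases hxi : x = i.1
    · exact hxi ▸ hi
    · exact Ideal.subset_span (Finset.mem_coe.mpr (Finset.mem_erase.mpr ⟨hxi, hx⟩))

end

/-! ### Finite reflection groups have polynomial rings of invariants -/

/-- If `s` acts trivially on the variables modulo `l`, then it acts trivially modulo `l`. -/
lemma dvd_sub_polyAct {s : GL (Fin 2) ℂ} {l : MvPolynomial (Fin 2) ℂ}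
    (h : ∀ i, l ∣ X i - polyAct s (X i)) (p : MvPolynomial (Fin 2) ℂ) :
    l ∣ p - polyAct s p := by
  have : (Ideal.Quotient.mkₐ ℂ (Ideal.span {l})) =
      (Ideal.Quotient.mkₐ ℂ (Ideal.span {l})).comp (polyAct s) :=
    MvPolynomial.algHom_ext fun i =>
      Ideal.Quotient.eq.mpr (Ideal.mem_span_singleton.mpr (h i))
  exact Ideal.mem_span_singleton.mp (Ideal.Quotient.eq.mp (DFunLike.congr_fun this p))

/-- A reflection has an equation `l` of its fixed line, and acts trivially modulo `l`. -/
lemma exists_dvd_sub_polyAct {s : GL (Fin 2) ℂ} (hs : IsReflection s) :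
    ∃ l : MvPolynomial (Fin 2) ℂ, 0 < l.totalDegree ∧ ∀ p, l ∣ p - polyAct s p := by
  obtain ⟨⟨v, hv⟩, hv0, -⟩ := finrank_eq_one_iff'.mp hs
  have hv0' : v ≠ 0 := fun h => hv0 (Subtype.ext h)
  have hsv : s.1 *ᵥ v = v := hv
  have hinv : (s⁻¹).1 *ᵥ v = v := by
    conv_lhs => rw [← hsv, Matrix.mulVec_mulVec, ← Units.val_mul, inv_mul_cancel, Units.val_one,
      Matrix.one_mulVec]
  set l : MvPolynomial (Fin 2) ℂ := C (v 1) * X 0 - C (v 0) * X 1 with hl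
  have hhom : l.IsHomogeneous 1 := (isHomogeneous_C_mul_X _ _).sub (isHomogeneous_C_mul_X _ _)
  have hl0 : l ≠ 0 := by
    intro h
    -- The coefficients of `l` are its values at the unit vectors.
    have h1 := congrArg (eval ![1, 0]) h
    have h2 := congrArg (eval ![0, 1]) h
    simp only [hl, map_sub, map_mul, eval_C, eval_X, map_zero] at h1 h2
    refine hv0' (funext fun i => ?_)
    fin_cases i
    · simpa using h2
    · simpa using h1
  refine ⟨l, by rw [hhom.totalDegree hl0]; exact one_pos, dvd_sub_polyAct fun i => ?_⟩
  obtain ⟨a, b, ha, hb⟩ : ∃ a b : ℂ, X i - polyAct s (X i) = C a * X 0 + C b * X 1 ∧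
      a * v 0 + b * v 1 = 0 := by
    have hi := congrFun hinv i
    rw [Matrix.mulVec, dotProduct, Fin.sum_univ_two] at hi
    rw [polyAct_X, Fin.sum_univ_two]
    generalize (s⁻¹).1 i 0 = m0 at *
    generalize (s⁻¹).1 i 1 = m1 at *
    fin_cases i
    · refine ⟨1 - m0, -m1, ?_, ?_⟩
      · simp only [map_sub, map_neg, map_one, Fin.zero_eta]
        ring
      · simp only [Fin.zero_eta] at hi
        linear_combination -hi
    · refine ⟨-m0, 1 - m1, ?_, ?_⟩
      · simp only [map_sub, map_neg, map_one, Fin.mk_one]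
        ring
      · simp only [Fin.mk_one] at hi
        linear_combination -hi
  rw [ha]
  obtain ⟨k, rfl, rfl⟩ : ∃ k, a = k * v 1 ∧ b = -(k * v 0) := by
    by_cases hv1 : v 1 = 0
    · have hv00 : v 0 ≠ 0 := fun h => hv0' (funext fun i => by fin_cases i <;> assumption)
      rw [hv1, mul_zero, add_zero] at hb
      refine ⟨-b / v 0, ?_, by field_simp⟩
      rw [(mul_eq_zero.mp hb).resolve_right hv00, hv1, mul_zero]
    · refine ⟨a / v 1, by field_simp, ?_⟩
      field_simp
      linear_combination hb
  refine ⟨C k, ?_⟩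
  rw [hl]
  simp only [map_mul, map_neg]
  ring

/-- In a linear relation between invariants over a reflection group, the coefficient of an
invariant which is not locally redundant at the origin lies in the Hilbert ideal.
For a reflection `s` with equation `l`, dividing the relation minus its `s`-translate by `l` lowers
the degree, so `p` is congruent to its translates, hence to its average, modulo the ideal. -/
lemma mem_hilbertIdeal_of_sum_mul_eq_zero {R : Subgroup (GL (Fin 2) ℂ)} [Finite R]
    (hR : Subgroup.closure (reflections R) = R) {ι : Type*} [DecidableEq ι] {K : Finset ι} {i₀ : ι}
    (hi₀ : i₀ ∈ K) {h : ι → MvPolynomial (Fin 2) ℂ} (hh : ∀ i, h i ∈ polyInvariants R)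
    (hmin : ∀ u ∈ polyInvariants R, ∀ c : ι → MvPolynomial (Fin 2) ℂ,
      (∀ i, c i ∈ polyInvariants R) → u * h i₀ = ∑ i ∈ K.erase i₀, c i * h i →
      constantCoeff u = 0)
    (p : ι → MvPolynomial (Fin 2) ℂ) (hp : ∑ i ∈ K, p i * h i = 0) :
    p i₀ ∈ hilbertIdeal R := by
  have := Fintype.ofFinite R
  induction hN : (p i₀).totalDegree using Nat.strong_induction_on generalizing p with
  | _ N ih =>
    have hrefl : ∀ s ∈ reflections R, p i₀ - polyAct s (p i₀) ∈ hilbertIdeal R := by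
      intro s hs
      obtain ⟨l, hl, hdvd⟩ := exists_dvd_sub_polyAct hs.2
      have hl0 : l ≠ 0 := by
        rintro rfl
        simp at hl
      choose q hq using fun i => hdvd (p i)
      have hqsum : ∑ i ∈ K, q i * h i = 0 := by
        refine (mul_eq_zero.mp ?_).resolve_left hl0
        have h2 : ∑ i ∈ K, polyAct s (p i) * h i = 0 := by
          have := congrArg (polyAct s) hp
          rw [map_sum, map_zero] at this
          rw [← this]
          exact Finset.sum_congr rfl fun i _ => by rw [map_mul, hh i s hs.1]
        rw [Finset.mul_sum, Finset.sum_congr rfl fun i _ =>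
          show l * (q i * h i) = p i * h i - polyAct s (p i) * h i by
            rw [← mul_assoc, ← hq, sub_mul], Finset.sum_sub_distrib, hp, h2, sub_zero]
      rw [hq]
      by_cases hq0 : q i₀ = 0
      · rw [hq0, mul_zero]
        exact zero_mem _
      · refine Ideal.mul_mem_left _ _ (ih _ ?_ q hqsum rfl)
        have h1 : (l * q i₀).totalDegree ≤ N := by
          rw [← hq]
          refine (totalDegree_sub _ _).trans (max_le hN.le ?_)
          exact (totalDegree_polyAct_le _ _).trans hN.le
        rw [totalDegree_mul_of_isDomain hl0 hq0] at h1
        omega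
    have hall : ∀ g ∈ R, p i₀ - polyAct g (p i₀) ∈ hilbertIdeal R := by
      intro g hg
      rw [← hR] at hg
      induction hg using Subgroup.closure_induction with
      | mem s hs => exact hrefl s hs
      | one => simp
      | mul x y hx _ ihx ihy =>
        rw [hR] at hx
        have := add_mem ihx (polyAct_mem_hilbertIdeal ihy hx)
        rwa [map_sub, ← polyAct_mul, sub_add_sub_cancel] at this
      | inv x hx ihx =>
        rw [hR] at hx
        have := neg_mem (polyAct_mem_hilbertIdeal ihx (inv_mem hx))
        rwa [map_sub, polyAct_inv_polyAct, neg_sub] at this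
    have hsub := sub_reynolds_mem hall
    have h0 : constantCoeff (reynolds R (p i₀)) = 0 := by
      refine hmin _ (reynolds_mem _) (fun i => -reynolds R (p i))
        (fun i => neg_mem (reynolds_mem _)) ?_
      have h1 : ∑ i ∈ K, reynolds R (p i) * h i = 0 := by
        have := congrArg (reynolds R) hp
        rw [map_sum, map_zero] at this
        rw [← this]
        exact Finset.sum_congr rfl fun i _ => (reynolds_mul (hh i) _).symm
      rw [← Finset.add_sum_erase _ _ hi₀] at h1
      simp only [neg_mul, Finset.sum_neg_distrib]
      exact eq_neg_of_add_eq_zero_left h1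
    have := add_mem hsub (mem_hilbertIdeal (reynolds_mem (p i₀)) h0)
    rwa [sub_add_cancel] at this

lemma totalDegree_pderiv_lt {ι : Type*} {P : MvPolynomial ι ℂ} {i : ι} (h : pderiv i P ≠ 0) :
    (pderiv i P).totalDegree < P.totalDegree := by
  obtain ⟨m, hm, hdeg⟩ : ∃ m ∈ (pderiv i P).support, (pderiv i P).totalDegree = m.degree := by
    obtain ⟨m, hm, h⟩ := Finset.exists_mem_eq_sup (pderiv i P).support
      (support_nonempty.mpr h) (fun s => s.sum fun _ e => e)
    exact ⟨m, hm, h⟩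
  rw [mem_support_iff, coeff_pderiv] at hm
  have h1 := le_totalDegree (mem_support_iff.mpr (left_ne_zero_of_mul hm))
  have h2 : ((m + Finsupp.single i 1).sum fun _ e => e) = m.degree + 1 := by
    change (m + Finsupp.single i 1).degree = _
    simp
  omega

lemma eq_C_of_pderiv_eq_zero {ι : Type*} {P : MvPolynomial ι ℂ} (h : ∀ i, pderiv i P = 0) :
    P = C (coeff 0 P) := by
  classical
  ext m
  rw [coeff_C]
  split_ifs with hm
  · rw [hm]
  · obtain ⟨i, hi⟩ : ∃ i, m i ≠ 0 := by
      by_contra! hc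
      exact hm (Finsupp.ext fun i => (hc i).symm)
    have h1 := coeff_pderiv (i := i) P (m - Finsupp.single i 1)
    rw [h i, coeff_zero, tsub_add_cancel_of_le
      (Finsupp.single_le_iff.mpr (Nat.one_le_iff_ne_zero.mpr hi))] at h1
    exact (mul_eq_zero.mp h1.symm).resolve_right (Nat.cast_add_one_ne_zero _)

lemma pderiv_aeval_eq_sum {ι σ : Type*} [Fintype ι] (f : ι → MvPolynomial σ ℂ) (s : σ)
    (P : MvPolynomial ι ℂ) :
    pderiv s (aeval f P) = ∑ i, aeval f (pderiv i P) * pderiv s (f i) := by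
  classical
  induction P using MvPolynomial.induction_on with
  | C a => simp
  | add p q hp hq => simp only [map_add, hp, hq, add_mul, Finset.sum_add_distrib]
  | mul_X p j hp =>
    simp only [map_mul, aeval_X, Derivation.leibniz, hp, smul_eq_mul, map_add, add_mul,
      Finset.sum_add_distrib, pderiv_X, Pi.single_apply]
    rw [Finset.mul_sum]
    congr 1
    · simp [Finset.sum_ite_eq]
    · exact Finset.sum_congr rfl fun i _ => by ring

/-- Homogeneous generators of the Hilbert ideal of a reflection group, none of which is redundant,
are algebraically independent.
The partial derivatives `h i` of a relation of least degree, evaluated at the generators, are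
invariants that do not all vanish. If `h i₀` belongs to a minimal local generating set of the ideal
they generate, then differentiating the relation and applying Euler's identity shows that the
generator `f i₀` is redundant. -/
lemma IsHilbertSystem.algebraicIndependent {R : Subgroup (GL (Fin 2) ℂ)} [Finite R]
    (hR : Subgroup.closure (reflections R) = R) {ι : Type*} [Fintype ι]
    {f : ι → MvPolynomial (Fin 2) ℂ} {d : ι → ℕ} (hf : IsHilbertSystem R f d)
    (hmin : ∀ i, f i ∉ Ideal.span (f '' {i}ᶜ)) : AlgebraicIndependent ℂ f := by
  classical
  by_contra hdep
  have hex : ∃ n, ∃ P : MvPolynomial ι ℂ, P.totalDegree = n ∧ P ≠ 0 ∧ aeval f P = 0 := by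
    rw [algebraicIndependent_iff] at hdep
    push Not at hdep
    obtain ⟨P, hP, hP0⟩ := hdep
    exact ⟨_, P, rfl, hP0, hP⟩
  obtain ⟨P, hPn, hP0, hP⟩ := Nat.find_spec hex
  set h : ι → MvPolynomial (Fin 2) ℂ := fun i => aeval f (pderiv i P) with hdef
  have hh : ∀ i, h i ∈ polyInvariants R := fun i => by
    rw [← hf.adjoin_eq, Algebra.adjoin_range_eq_range_aeval]
    exact ⟨_, rfl⟩
  obtain ⟨j₀, hj₀⟩ : ∃ j, h j ≠ 0 := by
    by_contra! hc
    have hd : ∀ i, pderiv i P = 0 := fun i => by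
      by_contra hne
      have hlt := totalDegree_pderiv_lt hne
      rw [hPn] at hlt
      exact Nat.find_min hex hlt ⟨_, rfl, hne, hc i⟩
    rw [eq_C_of_pderiv_eq_zero hd, algHom_C] at hP
    have h0 : coeff 0 P = 0 := C_injective (Fin 2) ℂ (hP.trans C_0.symm)
    exact hP0 (by rw [eq_C_of_pderiv_eq_zero hd, h0, C_0])
  -- `K` will index the fewest `h i` that generate all of them after inverting an invariant `u` with
  -- `u 0 ≠ 0`.
  have hexK : ∃ n, ∃ K : Finset ι, K.card = n ∧ ∃ u ∈ polyInvariants R, constantCoeff u ≠ 0 ∧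
      ∀ j, ∃ c : ι → MvPolynomial (Fin 2) ℂ, (∀ i, c i ∈ polyInvariants R) ∧
        u * h j = ∑ i ∈ K, c i * h i := by
    refine ⟨_, Finset.univ, rfl, 1, one_mem _, by simp, fun j => ⟨Pi.single j 1, fun i => ?_, ?_⟩⟩
    · rw [Pi.single_apply]
      split_ifs
      exacts [one_mem _, zero_mem _]
    · simp [Pi.single_apply]
  obtain ⟨K, hKn, u, hu, hu0, hK⟩ := Nat.find_spec hexK
  choose c hc hcsum using hK
  have hune : u ≠ 0 := fun h0 => hu0 (by rw [h0, map_zero])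
  obtain ⟨i₀, hi₀⟩ : K.Nonempty := by
    rw [Finset.nonempty_iff_ne_empty]
    rintro rfl
    have := hcsum j₀
    rw [Finset.sum_empty] at this
    exact (mul_ne_zero hune hj₀) this
  have hKmin : ∀ v ∈ polyInvariants R, ∀ c' : ι → MvPolynomial (Fin 2) ℂ,
      (∀ i, c' i ∈ polyInvariants R) → v * h i₀ = ∑ i ∈ K.erase i₀, c' i * h i →
      constantCoeff v = 0 := by
    intro v hv c' hc' hsum
    by_contra hv0
    refine Nat.find_min hexK (m := (K.erase i₀).card) ?_ ⟨_, rfl, u * v, mul_mem hu hv, ?_, fun j =>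
      ⟨fun i => v * c j i + c j i₀ * c' i, fun i => ?_, ?_⟩⟩
    · rw [← hKn]
      exact Finset.card_erase_lt_of_mem hi₀
    · rw [map_mul]
      exact mul_ne_zero hu0 hv0
    · exact add_mem (mul_mem hv (hc j i)) (mul_mem (hc j i₀) (hc' i))
    · have h1 : u * v * h j = v * (u * h j) := by ring
      rw [h1, hcsum, ← Finset.add_sum_erase _ _ hi₀, mul_add,
        show v * (c j i₀ * h i₀) = c j i₀ * (v * h i₀) by ring, hsum, Finset.mul_sum,
        Finset.mul_sum, ← Finset.sum_add_distrib]
      exact Finset.sum_congr rfl fun i _ => by ring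
  -- `e` is `c`, normalised so that the row of `i₀` is the trivial one.
  set e : ι → ι → MvPolynomial (Fin 2) ℂ := fun j => if j = i₀ then Pi.single i₀ u else c j with he
  have hesum : ∀ j, u * h j = ∑ i ∈ K, e j i * h i := by
    intro j
    by_cases hj : j = i₀
    · simp [he, hj, Pi.single_apply, hi₀]
    · simp only [he, if_neg hj]
      exact hcsum j
  have hmem : ∀ s, ∑ j, e j i₀ * pderiv s (f j) ∈ hilbertIdeal R := by
    intro s
    refine mem_hilbertIdeal_of_sum_mul_eq_zero hR hi₀ hh hKmin
      (fun i => ∑ j, e j i * pderiv s (f j)) ?_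
    have h1 := pderiv_aeval_eq_sum f s P
    rw [hP, map_zero] at h1
    calc ∑ i ∈ K, (∑ j, e j i * pderiv s (f j)) * h i
        = ∑ j, ∑ i ∈ K, (e j i * h i) * pderiv s (f j) := by
          rw [Finset.sum_comm]
          refine Finset.sum_congr rfl fun i _ => ?_
          rw [Finset.sum_mul]
          exact Finset.sum_congr rfl fun j _ => by ring
      _ = u * ∑ j, h j * pderiv s (f j) := by
          rw [Finset.mul_sum]
          refine Finset.sum_congr rfl fun j _ => ?_
          rw [← Finset.sum_mul, ← hesum, mul_assoc]
      _ = 0 := by rw [← h1, mul_zero]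
  choose a ha using fun s => Ideal.mem_span_range_iff_exists_fun.mp (hf.span.symm ▸ hmem s)
  -- Euler's identity turns the memberships `hmem` into a relation between the generators in which
  -- the coefficient `w i₀` of `f i₀` has a nonzero constant term.
  set w : ι → MvPolynomial (Fin 2) ℂ := fun j => e j i₀ * C (d j : ℂ) - ∑ s, X s * a s j with hw
  have hwsum : ∑ j, w j * f j = 0 := by
    have h1 : ∑ s, X s * ∑ j, a s j * f j = ∑ j, (e j i₀ * C (d j : ℂ)) * f j := by
      simp only [ha, Finset.mul_sum]
      rw [Finset.sum_comm]
      refine Finset.sum_congr rfl fun j _ => ?_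
      have h2 := (hf.homogeneous j).sum_X_mul_pderiv
      rw [← Nat.cast_smul_eq_nsmul ℂ, smul_eq_C_mul] at h2
      rw [mul_assoc, ← h2, Finset.mul_sum]
      exact Finset.sum_congr rfl fun s _ => by ring
    simp only [hw, sub_mul, Finset.sum_sub_distrib]
    rw [← h1, sub_eq_zero]
    simp only [Finset.mul_sum, Finset.sum_mul]
    rw [Finset.sum_comm]
    exact Finset.sum_congr rfl fun j _ => Finset.sum_congr rfl fun s _ => by ring
  have hw0 : constantCoeff (w i₀) ≠ 0 := by
    simp only [hw, he, if_true, Pi.single_eq_same, map_sub, map_mul, map_sum, constantCoeff_X,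
      zero_mul, Finset.sum_const_zero, sub_zero, constantCoeff_C]
    exact mul_ne_zero hu0 (Nat.cast_ne_zero.mpr (hf.pos i₀).ne')
  have hcomp := congrArg (homogeneousComponent (d i₀)) hwsum
  rw [map_zero, map_sum, ← Finset.add_sum_erase _ _ (Finset.mem_univ i₀),
    homogeneousComponent_mul_of_isHomogeneous (hf.homogeneous i₀), if_pos le_rfl, Nat.sub_self,
    homogeneousComponent_zero] at hcomp
  refine hmin i₀ ?_
  have h1 : C (coeff 0 (w i₀)) * f i₀ ∈ Ideal.span (f '' {i₀}ᶜ) := by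
    rw [eq_neg_of_add_eq_zero_left hcomp]
    refine neg_mem (Ideal.sum_mem _ fun j hj => ?_)
    rw [homogeneousComponent_mul_of_isHomogeneous (hf.homogeneous j)]
    split_ifs
    · exact Ideal.mul_mem_left _ _ (Ideal.subset_span ⟨j, Finset.ne_of_mem_erase hj, rfl⟩)
    · exact zero_mem _
  have h2 := Ideal.mul_mem_left _ (C (coeff 0 (w i₀))⁻¹) h1
  rw [constantCoeff_eq] at hw0
  rwa [← mul_assoc, ← C_mul, inv_mul_cancel₀ hw0, C_1, one_mul] at h2

/-- The monic polynomial whose roots are the translates of `p`. -/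
def orbitPoly (R : Subgroup (GL (Fin 2) ℂ)) [Fintype R] (p : MvPolynomial (Fin 2) ℂ) :
    Polynomial (MvPolynomial (Fin 2) ℂ) :=
  ∏ g : R, (Polynomial.X - Polynomial.C (polyAct g.1 p))

section

variable (R : Subgroup (GL (Fin 2) ℂ)) [Fintype R] (p : MvPolynomial (Fin 2) ℂ)

lemma orbitPoly_monic : (orbitPoly R p).Monic :=
  Polynomial.monic_prod_of_monic _ _ fun _ _ => Polynomial.monic_X_sub_C _

lemma eval_orbitPoly_self : (orbitPoly R p).eval p = 0 := by
  rw [orbitPoly, Polynomial.eval_prod]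
  refine Finset.prod_eq_zero (Finset.mem_univ 1) ?_
  simp

lemma coeff_orbitPoly_mem (n : ℕ) : (orbitPoly R p).coeff n ∈ polyInvariants R := by
  refine mem_polyInvariants.mpr fun g hg => ?_
  have : (orbitPoly R p).map (polyAct g).toRingHom = orbitPoly R p := by
    rw [orbitPoly, Polynomial.map_prod]
    refine Fintype.prod_equiv (Equiv.mulLeft (⟨g, hg⟩ : R)) _ _ fun h => ?_
    rw [Polynomial.map_sub, Polynomial.map_X, Polynomial.map_C, Equiv.coe_mulLeft,
      Subgroup.coe_mul, polyAct_mul]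
    rfl
  conv_rhs => rw [← this, Polynomial.coeff_map]
  rfl

end

lemma isIntegral_polyInvariants (R : Subgroup (GL (Fin 2) ℂ)) [Finite R] :
    Algebra.IsIntegral (polyInvariants R) (MvPolynomial (Fin 2) ℂ) := by
  have := Fintype.ofFinite R
  refine ⟨fun p => ?_⟩
  have hl : orbitPoly R p ∈ Polynomial.lifts (algebraMap (polyInvariants R) _) := by
    rw [Polynomial.lifts_iff_coeff_lifts]
    exact fun n => ⟨⟨_, coeff_orbitPoly_mem R p n⟩, rfl⟩
  obtain ⟨q, hq, -, hm⟩ := Polynomial.lifts_and_degree_eq_and_monic hl (orbitPoly_monic R p)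
  refine ⟨q, hm, ?_⟩
  rw [← Polynomial.eval_map, hq, eval_orbitPoly_self]

/-- The theorem of Chevalley–Shephard–Todd in the plane: for a finite group generated by
reflections, a minimal system of homogeneous generators of the Hilbert ideal is algebraically
independent, hence a transcendence basis of `ℂ(x, y)`, and so has two members. By
`IsHilbertSystem.adjoin_eq` these generate the algebra of invariants. -/
theorem exists_isHilbertSystem_fin_two {R : Subgroup (GL (Fin 2) ℂ)} [Finite R]
    (hR : Subgroup.closure (reflections R) = R) :
    ∃ (f : Fin 2 → MvPolynomial (Fin 2) ℂ) (d : Fin 2 → ℕ), IsHilbertSystem R f d ∧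
      ∀ i, f i ∉ Ideal.span (f '' {i}ᶜ) := by
  obtain ⟨t, d, ht, hmin⟩ := exists_isHilbertSystem R
  have hind := ht.algebraicIndependent hR hmin
  have hbasis : IsTranscendenceBasis ℂ (Subtype.val : t → MvPolynomial (Fin 2) ℂ) := by
    rw [hind.isTranscendenceBasis_iff_isAlgebraic]
    rw [ht.adjoin_eq]
    have := isIntegral_polyInvariants R
    infer_instance
  have hX : IsTranscendenceBasis ℂ (X : Fin 2 → MvPolynomial (Fin 2) ℂ) :=
    IsTranscendenceBasis.mvPolynomial _ _
  have hcard := hX.lift_cardinalMk_eq hbasis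
  have hcard' : Nonempty (Fin 2 ≃ t) := Cardinal.lift_mk_eq'.mp hcard
  obtain ⟨σ⟩ := hcard'
  refine ⟨fun i => (σ i).1, fun i => d (σ i), ⟨fun i => ht.mem _, fun i => ht.pos _,
    fun i => ht.homogeneous _, ?_⟩, fun i hi => hmin (σ i) ?_⟩
  · rw [← ht.span]
    congr 1
    exact σ.surjective.range_comp Subtype.val
  · refine Ideal.span_mono ?_ hi
    rintro _ ⟨j, hj, rfl⟩
    exact ⟨σ j, fun h => hj (σ.injective h), rfl⟩

/-! ### Equivariant generators -/

section

variable {R : Subgroup (GL (Fin 2) ℂ)}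

lemma polyAct_mem_polyInvariants {g : GL (Fin 2) ℂ} (hg : ∀ r ∈ R, g⁻¹ * r * g ∈ R)
    {b : MvPolynomial (Fin 2) ℂ} (hb : b ∈ polyInvariants R) : polyAct g b ∈ polyInvariants R :=
  mem_polyInvariants.mpr fun r hr => by
    have h := congrArg (polyAct g) (hb _ (hg r hr))
    rwa [← polyAct_mul, ← mul_assoc, ← mul_assoc, mul_inv_cancel, one_mul, polyAct_mul] at h

lemma eq_C_of_isHomogeneous_zero {a : MvPolynomial (Fin 2) ℂ} (h : a.IsHomogeneous 0) :
    a = C (coeff 0 a) := by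
  rw [← homogeneousComponent_zero, homogeneousComponent_eq_self h]

/-- A finite group `G` normalising the reflection group `R` acts linearly on the span of suitable
generators of the `R`-invariants. Only the case of generators of degrees `d 0 < d 1` needs an
argument: there `G` acts on `f 1` modulo `f 0` by a character, and `f 1` is replaced by its
average weighted by that character. -/
theorem exists_isHilbertSystem_equivariant [Finite R]
    (hR : Subgroup.closure (reflections R) = R) {G : Subgroup (GL (Fin 2) ℂ)} [Finite G]
    (hRG : ∀ g ∈ G, ∀ r ∈ R, g⁻¹ * r * g ∈ R) :
    ∃ (f : Fin 2 → MvPolynomial (Fin 2) ℂ) (d : Fin 2 → ℕ), IsHilbertSystem R f d ∧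
      ∀ g ∈ G, ∃ L : Matrix (Fin 2) (Fin 2) ℂ, ∀ i, polyAct g (f i) = ∑ j, C (L i j) * f j := by
  have := Fintype.ofFinite G
  obtain ⟨f, d, hf, hmin, hd⟩ : ∃ (f : Fin 2 → MvPolynomial (Fin 2) ℂ) (d : Fin 2 → ℕ),
      IsHilbertSystem R f d ∧ (∀ i, f i ∉ Ideal.span (f '' {i}ᶜ)) ∧ d 0 ≤ d 1 := by
    obtain ⟨f, d, hf, hmin⟩ := exists_isHilbertSystem_fin_two hR
    rcases le_total (d 0) (d 1) with h | h
    · exact ⟨f, d, hf, hmin, h⟩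
    · refine ⟨f ∘ Equiv.swap 0 1, d ∘ Equiv.swap 0 1, ⟨fun i => hf.mem _, fun i => hf.pos _,
        fun i => hf.homogeneous _, ?_⟩, fun i hi => hmin (Equiv.swap 0 1 i) ?_, by simpa using h⟩
      · rw [← hf.span, (Equiv.swap (0 : Fin 2) 1).surjective.range_comp f]
      · refine Ideal.span_mono ?_ hi
        rintro _ ⟨j, hj, rfl⟩
        exact ⟨_, fun h => hj ((Equiv.swap (0 : Fin 2) 1).injective h), rfl⟩
  have hact : ∀ g ∈ G, ∀ i, polyAct g (f i) ∈ polyInvariants R := fun g hg i =>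
    polyAct_mem_polyInvariants (hRG g hg) (hf.mem i)
  rcases hd.eq_or_lt with hd | hd
  · have hdd : ∀ i j, d i - d j = 0 := fun i j => by fin_cases i <;> fin_cases j <;> simp [hd]
    refine ⟨f, d, hf, fun g hg => ?_⟩
    choose a ha hah _ hsum using fun i =>
      hf.exists_eq_sum (hact g hg i) (hf.pos i) (isHomogeneous_polyAct (hf.homogeneous i) g)
    refine ⟨Matrix.of fun i j => coeff 0 (a i j), fun i => ?_⟩
    rw [hsum]
    refine Finset.sum_congr rfl fun j _ => ?_
    have := hah i j
    rw [hdd] at this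
    conv_lhs => rw [eq_C_of_isHomogeneous_zero this]
    rfl
  · have h0 : ∀ g ∈ G, ∃ c : ℂ, polyAct g (f 0) = C c * f 0 := by
      intro g hg
      obtain ⟨a, ha, hah, ha0, hsum⟩ := hf.exists_eq_sum (hact g hg 0) (hf.pos 0)
        (isHomogeneous_polyAct (hf.homogeneous 0) g)
      have h := hah 0
      rw [Nat.sub_self] at h
      rw [Fin.sum_univ_two, ha0 1 hd, zero_mul, add_zero, eq_C_of_isHomogeneous_zero h] at hsum
      exact ⟨_, hsum⟩
    have h1 : ∀ g : G, ∃ (a : MvPolynomial (Fin 2) ℂ) (c : ℂ),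
        polyAct g.1 (f 1) = a * f 0 + C c * f 1 := by
      intro g
      obtain ⟨a, ha, hah, -, hsum⟩ := hf.exists_eq_sum (hact g.1 g.2 1) (hf.pos 1)
        (isHomogeneous_polyAct (hf.homogeneous 1) g.1)
      have h := hah 1
      rw [Nat.sub_self] at h
      rw [Fin.sum_univ_two, eq_C_of_isHomogeneous_zero h] at hsum
      exact ⟨_, _, hsum⟩
    choose a c hac using h1
    have huniq : ∀ (a a' : MvPolynomial (Fin 2) ℂ) (c c' : ℂ),
        a * f 0 + C c * f 1 = a' * f 0 + C c' * f 1 → c = c' := by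
      intro a a' c c' h
      by_contra hne
      refine hmin 1 ?_
      have h2 : f 1 = C (c - c')⁻¹ * (a' - a) * f 0 := by
        have h3 : C (c - c')⁻¹ * C (c - c') = (1 : MvPolynomial (Fin 2) ℂ) := by
          rw [← C_mul, inv_mul_cancel₀ (sub_ne_zero.mpr hne), C_1]
        rw [C_sub] at h3
        linear_combination C (c - c')⁻¹ * h - f 1 * h3
      rw [h2]
      exact Ideal.mul_mem_left _ _ (Ideal.subset_span ⟨0, by simp, rfl⟩)
    have hcone : c 1 = 1 := huniq (a 1) 0 _ _ (by rw [← hac]; simp)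
    have hcmul : ∀ g h : G, c (g * h) = c g * c h := by
      intro g h
      obtain ⟨x, hx⟩ := h0 g.1 g.2
      refine huniq (a (g * h)) (polyAct g.1 (a h) * C x + C (c h) * a g) _ _ ?_
      rw [← hac, Subgroup.coe_mul, polyAct_mul, hac h, map_add, map_mul, map_mul, hx, hac g,
        polyAct_C, C_mul]
      ring
    have hcne : ∀ g, c g ≠ 0 := fun g hg => by
      have := hcmul g g⁻¹
      rw [mul_inv_cancel, hcone, hg, zero_mul] at this
      exact one_ne_zero this
    set N : ℂ := (Fintype.card G : ℂ)⁻¹ with hN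
    have hNcard : N * Fintype.card G = 1 := inv_mul_cancel₀ (by exact_mod_cast Fintype.card_ne_zero)
    set F : MvPolynomial (Fin 2) ℂ := C N * ∑ g : G, C (c g)⁻¹ * polyAct g.1 (f 1) with hF
    have hFact : ∀ h : G, polyAct h.1 F = C (c h) * F := by
      intro h
      rw [hF, map_mul, polyAct_C, map_sum, mul_left_comm]
      refine congrArg (C N * ·) ?_
      rw [Finset.mul_sum]
      refine Fintype.sum_equiv (Equiv.mulLeft h) _ _ fun g => ?_
      rw [map_mul, polyAct_C, Equiv.coe_mulLeft, hcmul, Subgroup.coe_mul, polyAct_mul,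
        ← mul_assoc, ← C_mul]
      refine congrArg (C · * _) ?_
      have h1 := hcne h
      have h2 := hcne g
      field_simp
    have hFeq : F = (C N * ∑ g : G, C (c g)⁻¹ * a g) * f 0 + f 1 := by
      have h2 : C N * ∑ _g : G, f 1 = f 1 := by
        rw [Finset.sum_const, Finset.card_univ, nsmul_eq_mul, ← mul_assoc, ← map_natCast C,
          ← C_mul, hNcard, C_1, one_mul]
      conv_rhs => rw [← h2]
      rw [hF, mul_assoc, ← mul_add, Finset.sum_mul, ← Finset.sum_add_distrib]
      congr 1
      refine Finset.sum_congr rfl fun g _ => ?_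
      have h3 : C (c g)⁻¹ * C (c g) = (1 : MvPolynomial (Fin 2) ℂ) := by
        rw [← C_mul, inv_mul_cancel₀ (hcne g), C_1]
      rw [hac]
      linear_combination f 1 * h3
    refine ⟨![f 0, F], d, ⟨fun i => ?_, hf.pos, fun i => ?_, ?_⟩, fun g hg => ?_⟩
    · fin_cases i
      · exact hf.mem 0
      · exact mul_mem (Subalgebra.algebraMap_mem _ N) (Subalgebra.sum_mem _ fun g _ =>
          mul_mem (Subalgebra.algebraMap_mem _ (c g)⁻¹) (hact g.1 g.2 1))
    · fin_cases i
      · exact hf.homogeneous 0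
      · exact (IsHomogeneous.sum _ _ _ fun g _ =>
          (isHomogeneous_polyAct (hf.homogeneous 1) g.1).C_mul _).C_mul _
    · have hr : ∀ h : Fin 2 → MvPolynomial (Fin 2) ℂ, Set.range h = {h 0, h 1} := fun h => by
        ext x
        simp [eq_comm]
      rw [← hf.span, hr, hr, Matrix.cons_val_zero, Matrix.cons_val_one, Matrix.cons_val_fin_one,
        hFeq]
      exact Ideal.span_pair_mul_left_add _ _ _
    · obtain ⟨x, hx⟩ := h0 g hg
      refine ⟨!![x, 0; 0, c ⟨g, hg⟩], fun i => ?_⟩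
      fin_cases i
      · simpa [Fin.sum_univ_two] using hx
      · simpa [Fin.sum_univ_two] using hFact ⟨g, hg⟩

/-- Two generators are automatically independent, since the invariants have transcendence degree
two. -/
lemma IsHilbertSystem.algebraicIndependent_fin_two [Finite R]
    {f : Fin 2 → MvPolynomial (Fin 2) ℂ} {d : Fin 2 → ℕ} (hf : IsHilbertSystem R f d) :
    AlgebraicIndependent ℂ f := by
  have : Algebra.IsAlgebraic (Algebra.adjoin ℂ (Set.range f)) (MvPolynomial (Fin 2) ℂ) := by
    rw [hf.adjoin_eq]
    have := isIntegral_polyInvariants R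
    infer_instance
  exact (Algebra.IsAlgebraic.isTranscendenceBasis_of_le_trdeg_of_finite ℂ f
    (by rw [MvPolynomial.trdeg_of_isDomain]; simp)).1

end

/-! ### The linear action on the quotient by a reflection group -/

lemma eq_of_polyAct_X_eq {g h : GL (Fin 2) ℂ} (H : ∀ i, polyAct g (X i) = polyAct h (X i)) :
    g = h := by
  refine inv_injective (Units.ext (Matrix.ext fun i j => ?_))
  have := congrArg (eval (Pi.single j 1)) (H i)
  simpa [polyAct_X, Pi.single_apply, -Fin.sum_univ_two] using this

section

variable {R : Subgroup (GL (Fin 2) ℂ)}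

/-- A polynomial and its translate under an automorphism fixing all invariants of `R` are conjugate
under `R`, because both are roots of the orbit polynomial. -/
lemma exists_polyAct_eq_polyAct [Finite R] {g : GL (Fin 2) ℂ}
    (h : ∀ b ∈ polyInvariants R, polyAct g b = b) (p : MvPolynomial (Fin 2) ℂ) :
    ∃ r : R, polyAct g p = polyAct r.1 p := by
  have := Fintype.ofFinite R
  have hmap : (orbitPoly R p).map (polyAct g).toRingHom = orbitPoly R p := by
    ext1 n
    rw [Polynomial.coeff_map]
    exact h _ (coeff_orbitPoly_mem R p n)
  have hroot : (orbitPoly R p).eval (polyAct g p) = 0 := by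
    have h1 : ((orbitPoly R p).map (polyAct g).toRingHom).eval ((polyAct g).toRingHom p) = 0 := by
      rw [Polynomial.eval_map_apply, eval_orbitPoly_self, map_zero]
    rwa [hmap] at h1
  rw [orbitPoly, Polynomial.eval_prod, Finset.prod_eq_zero_iff] at hroot
  obtain ⟨r, -, hr⟩ := hroot
  rw [Polynomial.eval_sub, Polynomial.eval_X, Polynomial.eval_C] at hr
  exact ⟨r, sub_eq_zero.mp hr⟩

/-- The invariants of a finite group determine the group. -/
lemma mem_of_forall_polyAct_eq [Finite R] {g : GL (Fin 2) ℂ}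
    (h : ∀ b ∈ polyInvariants R, polyAct g b = b) : g ∈ R := by
  choose r hr using fun c : ℂ => exists_polyAct_eq_polyAct h (X 0 + C c * X 1)
  -- Of the infinitely many forms `X 0 + c X 1`, two are moved by the same element of `R`.
  obtain ⟨a, b, hab, hrab⟩ := Finite.exists_ne_map_eq_of_infinite r
  have ha := hr a
  have hb := hr b
  rw [← hrab] at hb
  simp only [map_add, map_mul, polyAct_C] at ha hb
  have hne : (C (a - b) : MvPolynomial (Fin 2) ℂ) ≠ 0 := by
    rw [Ne, ← C_0 (σ := Fin 2), (C_injective (Fin 2) ℂ).eq_iff]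
    exact sub_ne_zero.mpr hab
  have h1 : polyAct g (X 1) = polyAct (r a).1 (X 1) := by
    refine mul_left_cancel₀ hne ?_
    rw [C_sub]
    linear_combination ha - hb
  have h0 : polyAct g (X 0) = polyAct (r a).1 (X 0) := by
    rw [h1] at ha
    exact add_right_cancel ha
  have : g = (r a).1 := eq_of_polyAct_X_eq fun i => by
    fin_cases i
    exacts [h0, h1]
  exact this ▸ (r a).2

variable {f : Fin 2 → MvPolynomial (Fin 2) ℂ} {d : Fin 2 → ℕ}

lemma IsHilbertSystem.exists_aeval_eq [Finite R] (hf : IsHilbertSystem R f d)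
    {b : MvPolynomial (Fin 2) ℂ} (hb : b ∈ polyInvariants R) : ∃ q, aeval (R := ℂ) f q = b := by
  rw [← hf.adjoin_eq, Algebra.adjoin_range_eq_range_aeval] at hb
  exact hb

/-- The origin is the only common zero of the members of a Hilbert system: an invariant takes the
same value at any common zero as at the origin, and the coordinates are integral over the
invariants. -/
lemma IsHilbertSystem.eq_zero_of_eval_eq_zero [Finite R] (hf : IsHilbertSystem R f d)
    {v : Fin 2 → ℂ} (hv : ∀ i, eval v (f i) = 0) : v = 0 := by
  have := Fintype.ofFinite R
  have hB : ∀ b ∈ polyInvariants R, eval v b = constantCoeff b := by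
    intro b hb
    have h0 : b - C (constantCoeff b) ∈ hilbertIdeal R :=
      mem_hilbertIdeal (sub_mem hb (Subalgebra.algebraMap_mem _ _)) (by simp)
    have hle : hilbertIdeal R ≤ RingHom.ker (eval v) := by
      rw [← hf.span, Ideal.span_le]
      rintro _ ⟨i, rfl⟩
      exact hv i
    have h1 := hle h0
    rw [RingHom.mem_ker, map_sub, eval_C, sub_eq_zero] at h1
    exact h1
  funext i
  have hmap : (orbitPoly R (X i)).map (eval v) = (orbitPoly R (X i)).map constantCoeff := by
    ext1 n
    rw [Polynomial.coeff_map, Polynomial.coeff_map]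
    exact hB _ (coeff_orbitPoly_mem R _ n)
  have h1 : (orbitPoly R (X i)).map constantCoeff = Polynomial.X ^ Fintype.card R := by
    simp [orbitPoly, Polynomial.map_prod]
  have h2 : ((orbitPoly R (X i)).map (eval v)).eval (eval v (X i)) = 0 := by
    rw [Polynomial.eval_map_apply, eval_orbitPoly_self, map_zero]
  rw [hmap, h1, Polynomial.eval_pow, Polynomial.eval_X, eval_X] at h2
  exact eq_zero_of_pow_eq_zero h2

variable {G : Subgroup (GL (Fin 2) ℂ)}

/-- The linear action on the plane `V/R`, with coordinates a Hilbert system, of a group acting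
linearly on that system. -/
lemma IsHilbertSystem.exists_monoidHom [Finite R] (hf : IsHilbertSystem R f d)
    (hG : ∀ g ∈ G, ∃ L : Matrix (Fin 2) (Fin 2) ℂ, ∀ i,
      polyAct g (f i) = ∑ j, C (L i j) * f j) :
    ∃ ρ : G →* GL (Fin 2) ℂ, ∀ g p, aeval f (polyAct (ρ g) p) = polyAct g.1 (aeval f p) := by
  have huniq : ∀ L M : Matrix (Fin 2) (Fin 2) ℂ,
      (∀ i, ∑ j, C (L i j) * f j = ∑ j, C (M i j) * f j) → L = M := by
    intro L M h
    have hlin := Fintype.linearIndependent_iff.mp hf.algebraicIndependent_fin_two.linearIndependent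
    ext i j
    refine sub_eq_zero.mp (hlin (fun j => L i j - M i j) ?_ j)
    have := sub_eq_zero.mpr (h i)
    rw [← Finset.sum_sub_distrib] at this
    rw [← this]
    exact Finset.sum_congr rfl fun j _ => by rw [smul_eq_C_mul, C_sub, sub_mul]
  choose L hL using fun g : G => hG g.1 g.2
  have hone : L 1 = 1 := huniq _ _ fun i => by
    rw [← hL]
    simp [Matrix.one_apply, -Fin.sum_univ_two]
  have hmul : ∀ g h, L (g * h) = L h * L g := fun g h => huniq _ _ fun i => by
    rw [← hL, Subgroup.coe_mul, polyAct_mul, hL h, map_sum]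
    simp only [map_mul, polyAct_C, hL g, Matrix.mul_apply, map_sum, Finset.sum_mul, Finset.mul_sum]
    rw [Finset.sum_comm]
    exact Finset.sum_congr rfl fun j _ => Finset.sum_congr rfl fun k _ => by ring
  -- `L` reverses products because the action on functions is contragredient.
  let ρ : G →* GL (Fin 2) ℂ := MonoidHom.toHomUnits
    { toFun := fun g => L g⁻¹
      map_one' := by rw [inv_one, hone]
      map_mul' := fun g h => by rw [_root_.mul_inv_rev, hmul] }
  refine ⟨ρ, fun g p => ?_⟩
  have hρ : ((ρ g)⁻¹).1 = L g := by
    rw [← map_inv]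
    change L g⁻¹⁻¹ = L g
    rw [inv_inv]
  suffices (aeval f).comp (polyAct (ρ g)) = (polyAct g.1).comp (aeval f) from
    DFunLike.congr_fun this p
  refine MvPolynomial.algHom_ext fun i => ?_
  rw [AlgHom.comp_apply, AlgHom.comp_apply, aeval_X, hL, polyAct_X, map_sum, hρ]
  exact Finset.sum_congr rfl fun j _ => by rw [map_mul, aeval_X, algHom_C, algebraMap_eq]

variable {ρ : G →* GL (Fin 2) ℂ}

/-- The kernel of the action on `V/R` is `R`. -/
lemma IsHilbertSystem.monoidHom_eq_one_iff [Finite R] (hf : IsHilbertSystem R f d)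
    (hρ : ∀ g p, aeval f (polyAct (ρ g) p) = polyAct g.1 (aeval f p)) (g : G) :
    ρ g = 1 ↔ g.1 ∈ R := by
  constructor
  · intro h
    refine mem_of_forall_polyAct_eq fun b hb => ?_
    obtain ⟨q, rfl⟩ := hf.exists_aeval_eq hb
    rw [← hρ, h, polyAct_one]
  · intro h
    refine eq_of_polyAct_X_eq fun i => ?_
    have hinj : Function.Injective (aeval (R := ℂ) f) := hf.algebraicIndependent_fin_two
    apply hinj
    rw [hρ, aeval_X, hf.mem i _ h, polyAct_one, aeval_X]

/-- If `g` fixes `v`, then its action on `V/R` fixes the image of `v`. -/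
lemma mulVec_eval_eq_self
    (hρ : ∀ g p, aeval f (polyAct (ρ g) p) = polyAct g.1 (aeval f p)) {g : G} {v : Fin 2 → ℂ}
    (hv : g.1.1 *ᵥ v = v) :
    (ρ g).1 *ᵥ (fun i => eval v (f i)) = fun i => eval v (f i) := by
  have hev : ∀ p, eval v (aeval f p) = eval (fun i => eval v (f i)) p := fun p => by
    rw [aeval_def, eval_eval₂, eval₂_eq_eval_map]
    congr 1
    rw [show (eval v).comp (algebraMap ℂ (MvPolynomial (Fin 2) ℂ)) = RingHom.id ℂ by ext; simp,
      MvPolynomial.map_id]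
  funext i
  have h1 : eval v (polyAct (g⁻¹).1 (f i)) = eval v (f i) := by
    rw [eval_polyAct, Subgroup.coe_inv, inv_inv, hv]
  have h2 := hρ g⁻¹ (X i)
  rw [aeval_X] at h2
  rw [← h2, hev, eval_polyAct, map_inv, inv_inv, eval_X] at h1
  exact h1

end

lemma det_eq_neg_one_of_mul_self_eq_one {M : Matrix (Fin 2) (Fin 2) ℂ} (h2 : M * M = 1)
    (h1 : M ≠ 1) {w : Fin 2 → ℂ} (hw : w ≠ 0) (hMw : M *ᵥ w = w) : M.det = -1 := by
  have hdet : (M - 1).det = 0 :=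
    Matrix.exists_mulVec_eq_zero_iff.mp ⟨w, hw, by rw [Matrix.sub_mulVec, hMw, Matrix.one_mulVec,
      sub_self]⟩
  by_contra hne
  have e : ∀ i j, (M * M) i j = (1 : Matrix (Fin 2) (Fin 2) ℂ) i j := fun i j => by rw [h2]
  have e00 := e 0 0
  have e01 := e 0 1
  have e10 := e 1 0
  have e11 := e 1 1
  simp only [Matrix.mul_apply, Fin.sum_univ_two, Matrix.one_apply_eq, ne_eq, zero_ne_one,
    not_false_eq_true, one_ne_zero, Matrix.one_apply_ne] at e00 e01 e10 e11
  rw [Matrix.det_fin_two] at hdet hne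
  simp only [Matrix.sub_apply, Matrix.one_apply_eq, ne_eq, zero_ne_one,
    not_false_eq_true, one_ne_zero, Matrix.one_apply_ne] at hdet
  -- Since `1` is an eigenvalue, `tr M = 1 + det M`, and then `(1 + det M) (M - 1) = M ^ 2 - 1`.
  have hd : 1 + (M 0 0 * M 1 1 - M 0 1 * M 1 0) ≠ 0 := fun h => hne (by linear_combination h)
  refine h1 (Matrix.ext fun i j => ?_)
  refine mul_left_cancel₀ hd ?_
  fin_cases i <;> fin_cases j <;>
    simp only [Fin.zero_eta, Fin.mk_one, Matrix.one_apply_eq, ne_eq, zero_ne_one,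
      not_false_eq_true, one_ne_zero, Matrix.one_apply_ne]
  · linear_combination e00 + (M 0 0) * hdet
  · linear_combination e01 + (M 0 1) * hdet
  · linear_combination e10 + (M 1 0) * hdet
  · linear_combination e11 + (M 1 1) * hdet

/-! ### The subgroup generated by the reflections in `Γ` -/

/-- A nontrivial matrix with a nonzero fixed vector is a reflection. -/
lemma isReflection_of_ne_one {s : GL (Fin 2) ℂ} (hs : s ≠ 1) {v : Fin 2 → ℂ} (hv0 : v ≠ 0)
    (hv : s.1 *ᵥ v = v) : IsReflection s := by
  have hpos : 0 < Module.finrank ℂ (fixedSpace s) :=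
    Module.finrank_pos_iff_exists_ne_zero.mpr ⟨⟨v, hv⟩, fun h => hv0 (congrArg Subtype.val h)⟩
  have hlt : Module.finrank ℂ (fixedSpace s) < 2 := by
    have h2 : Module.finrank ℂ (Fin 2 → ℂ) = 2 := by simp
    refine (Submodule.finrank_lt fun htop => hs (Units.ext ?_)).trans_eq h2
    refine Matrix.ext_of_mulVec_single fun i => ?_
    have : Pi.single i 1 ∈ fixedSpace s := htop ▸ Submodule.mem_top
    rw [Units.val_one, Matrix.one_mulVec]
    exact this
  unfold IsReflection
  omega

lemma IsReflection.exists_mulVec_eq {s : GL (Fin 2) ℂ} (hs : IsReflection s) :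
    ∃ v : Fin 2 → ℂ, v ≠ 0 ∧ s.1 *ᵥ v = v := by
  obtain ⟨⟨v, hv⟩, hv0, -⟩ := finrank_eq_one_iff'.mp hs
  exact ⟨v, fun h => hv0 (Subtype.ext h), hv⟩

lemma IsReflection.ne_one {s : GL (Fin 2) ℂ} (hs : IsReflection s) : s ≠ 1 := by
  rintro rfl
  have htop : fixedSpace 1 = ⊤ := eq_top_iff.mpr fun v _ => by
    change (1 : GL (Fin 2) ℂ).1 *ᵥ v = v
    rw [Units.val_one, Matrix.one_mulVec]
  have h : Module.finrank ℂ (fixedSpace 1) = 1 := hs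
  rw [htop, finrank_top] at h
  simp at h

lemma IsReflection.conj {s : GL (Fin 2) ℂ} (hs : IsReflection s) (g : GL (Fin 2) ℂ) :
    IsReflection (g * s * g⁻¹) := by
  obtain ⟨v, hv0, hv⟩ := hs.exists_mulVec_eq
  refine isReflection_of_ne_one (fun h => hs.ne_one (conj_eq_one_iff.mp h)) (v := g.1 *ᵥ v)
    (fun h => hv0 ?_) ?_
  · have := congrArg ((g⁻¹).1 *ᵥ ·) h
    simpa only [Matrix.mulVec_mulVec, ← Units.val_mul, inv_mul_cancel, Units.val_one,
      Matrix.one_mulVec, Matrix.mulVec_zero] using this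
  · rw [Matrix.mulVec_mulVec, ← Units.val_mul, inv_mul_cancel_right, Units.val_mul,
      ← Matrix.mulVec_mulVec, hv]

lemma IsReflection.mul_self {s : GL (Fin 2) ℂ} (hs : IsReflection s) (h : s * s ≠ 1) :
    IsReflection (s * s) := by
  obtain ⟨v, hv0, hv⟩ := hs.exists_mulVec_eq
  exact isReflection_of_ne_one h hv0 (by rw [Units.val_mul, ← Matrix.mulVec_mulVec, hv, hv])

section

variable {Γ : Subgroup (GL (Fin 2) ℂ)}

lemma closure_reflections_le (Γ : Subgroup (GL (Fin 2) ℂ)) :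
    Subgroup.closure (reflections Γ) ≤ Γ :=
  (Subgroup.closure_le _).mpr fun _ hs => hs.1

lemma closure_reflections_closure_reflections (Γ : Subgroup (GL (Fin 2) ℂ)) :
    Subgroup.closure (reflections (Subgroup.closure (reflections Γ))) =
      Subgroup.closure (reflections Γ) :=
  le_antisymm (closure_reflections_le _)
    (Subgroup.closure_mono fun _ hs => ⟨Subgroup.subset_closure hs, hs.2⟩)

lemma conj_mem_closure_reflections {g : GL (Fin 2) ℂ} (hg : ∀ r ∈ Γ, g * r * g⁻¹ ∈ Γ) :
    ∀ r ∈ Subgroup.closure (reflections Γ), g * r * g⁻¹ ∈ Subgroup.closure (reflections Γ) := by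
  have : Subgroup.closure (reflections Γ) ≤
      (Subgroup.closure (reflections Γ)).comap (MulAut.conj g).toMonoidHom :=
    (Subgroup.closure_le _).mpr fun s hs =>
      Subgroup.subset_closure ⟨hg s hs.1, hs.2.conj g⟩
  exact fun r hr => this hr

variable {G : Subgroup (GL (Fin 2) ℂ)}

/-- Let `Γ` have index two in the reflection group `G`, let `R` be generated by the reflections of
`Γ`, and let `ρ` be the action of `G` on the plane `V/R`. Then `det ρ` is the sign character of
`G` with kernel `Γ`. Indeed a reflection `s ∉ Γ` has `s ^ 2 ∈ R`, so that `ρ s` is an involution,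
and it fixes the image of the fixed line of `s`; hence `det (ρ s) = -1`. -/
lemma det_monoidHom_eq_one_of_mem (hG : Subgroup.closure (reflections G) = G)
    (hindex : Γ.relIndex G = 2) [Finite (Subgroup.closure (reflections Γ))]
    {f : Fin 2 → MvPolynomial (Fin 2) ℂ} {d : Fin 2 → ℕ}
    (hf : IsHilbertSystem (Subgroup.closure (reflections Γ)) f d) {ρ : G →* GL (Fin 2) ℂ}
    (hρ : ∀ g p, aeval f (polyAct (ρ g) p) = polyAct g.1 (aeval f p)) {g : G} (hg : g.1 ∈ Γ) :
    (ρ g).1.det = 1 := by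
  have hmem : ∀ x y : G, (x * y).1 ∈ Γ ↔ (x.1 ∈ Γ ↔ y.1 ∈ Γ) := fun x y => by
    have := Subgroup.mul_mem_iff_of_index_two (H := Γ.subgroupOf G) hindex (a := x) (b := y)
    simpa only [Subgroup.mem_subgroupOf] using this
  suffices H : ∀ x (hx : x ∈ G), (x ∈ Γ ∧ (ρ ⟨x, hx⟩).1.det = 1) ∨
      (x ∉ Γ ∧ (ρ ⟨x, hx⟩).1.det = -1) from
    ((H g.1 g.2).resolve_right fun h => h.1 hg).2
  intro x hx
  have hx' := hx
  rw [← hG] at hx'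
  induction hx' using Subgroup.closure_induction with
  | mem s hs =>
    by_cases hsΓ : s ∈ Γ
    · left
      have : ρ ⟨s, hx⟩ = 1 :=
        (hf.monoidHom_eq_one_iff hρ _).mpr (Subgroup.subset_closure ⟨hsΓ, hs.2⟩)
      rw [this, Units.val_one, Matrix.det_one]
      exact ⟨hsΓ, rfl⟩
    · refine Or.inr ⟨hsΓ, ?_⟩
      obtain ⟨v, hv0, hv⟩ := hs.2.exists_mulVec_eq
      refine det_eq_neg_one_of_mul_self_eq_one ?_ ?_ (fun h => hv0 ?_)
        (mulVec_eval_eq_self hρ (g := ⟨s, hx⟩) hv)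
      · rw [← Units.val_mul, ← map_mul, ← Units.val_one, Units.val_inj,
          hf.monoidHom_eq_one_iff hρ]
        by_cases hss : s * s = 1
        · exact (show s * s ∈ _ from hss ▸ one_mem _)
        · exact Subgroup.subset_closure
            ⟨(hmem ⟨s, hx⟩ ⟨s, hx⟩).mpr Iff.rfl, hs.2.mul_self hss⟩
      · rw [← Units.val_one, Ne, Units.val_inj, hf.monoidHom_eq_one_iff hρ]
        exact fun h => hsΓ (closure_reflections_le Γ h)
      · exact hf.eq_zero_of_eval_eq_zero fun i => congrFun h i
  | one =>
    left
    rw [show ρ ⟨1, hx⟩ = 1 from map_one ρ, Units.val_one, Matrix.det_one]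
    exact ⟨one_mem _, rfl⟩
  | mul x y hxc hyc ihx ihy =>
    rw [hG] at hxc hyc
    have h1 : ρ ⟨x * y, hx⟩ = ρ ⟨x, hxc⟩ * ρ ⟨y, hyc⟩ := map_mul ρ ⟨x, hxc⟩ ⟨y, hyc⟩
    have h2 := hmem ⟨x, hxc⟩ ⟨y, hyc⟩
    rw [h1, Units.val_mul, Matrix.det_mul]
    change (x * y ∈ Γ ↔ (x ∈ Γ ↔ y ∈ Γ)) at h2
    rw [h2]
    rcases ihx hxc with ⟨hx1, hx2⟩ | ⟨hx1, hx2⟩ <;> rcases ihy hyc with ⟨hy1, hy2⟩ | ⟨hy1, hy2⟩ <;>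
      simp [hx1, hx2, hy1, hy2]
  | inv x hxc ihx =>
    rw [hG] at hxc
    have h1 : ρ ⟨x⁻¹, hx⟩ * ρ ⟨x, hxc⟩ = 1 := by
      rw [← map_mul]
      exact (congrArg ρ (Subtype.ext (inv_mul_cancel x))).trans (map_one ρ)
    have h2 := congrArg (fun m : GL (Fin 2) ℂ => m.1.det) h1
    rw [Units.val_mul, Matrix.det_mul, Units.val_one, Matrix.det_one] at h2
    rw [inv_mem_iff]
    rcases ihx hxc with ⟨hx1, hx2⟩ | ⟨hx1, hx2⟩
    · rw [hx2, mul_one] at h2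
      exact Or.inl ⟨hx1, h2⟩
    · rw [hx2] at h2
      exact Or.inr ⟨hx1, by linear_combination -h2⟩

end

end

end PlaneQuotient

/-! ### Adic completions and complete filtered algebras -/

namespace PlaneQuotient

noncomputable section

section

variable {k B E : Type*} [CommRing k] [CommRing B] [CommRing E] [Algebra k B] [Algebra k E]
  {m : Ideal B} {J : ℕ → Ideal E} {φ : B →ₐ[k] E}

/-- `y` is the limit, for the filtration `J` of `E`, of the images of representatives of the
components of `x`. -/
def IsFilteredLimit (J : ℕ → Ideal E) (φ : B →ₐ[k] E) (x : AdicCompletion m B) (y : E) : Prop :=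
  ∀ n b, Ideal.Quotient.mk (m ^ n) b = AdicCompletion.evalₐ m n x → y - φ b ∈ J n

lemma exists_mk_eq_evalₐ (x : AdicCompletion m B) (n : ℕ) :
    ∃ b, Ideal.Quotient.mk (m ^ n) b = AdicCompletion.evalₐ m n x :=
  Ideal.Quotient.mk_surjective _

lemma mk_eq_evalₐ_of_le {x : AdicCompletion m B} {n n' : ℕ} (hn : n ≤ n') {b : B}
    (hb : Ideal.Quotient.mk (m ^ n') b = AdicCompletion.evalₐ m n' x) :
    Ideal.Quotient.mk (m ^ n) b = AdicCompletion.evalₐ m n x := by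
  obtain ⟨c, rfl⟩ := AdicCompletion.mk_surjective m B x
  rw [AdicCompletion.evalₐ_mk] at hb ⊢
  rw [Ideal.Quotient.eq] at hb
  rw [← AdicCompletion.Ideal.mk_eq_mk m hn c, Ideal.Quotient.eq]
  exact Ideal.pow_le_pow_right hn hb

variable (hpow : ∀ n, ∀ b ∈ m ^ n, φ b ∈ J n)
include hpow

lemma isFilteredLimit_algebraMap (r : k) :
    IsFilteredLimit J φ (algebraMap k (AdicCompletion m B) r) (algebraMap k E r) := by
  intro n b hb
  rw [AdicCompletion.algebraMap_apply, AdicCompletion.evalₐ_of, eq_comm, Ideal.Quotient.eq] at hb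
  have := hpow n _ hb
  rwa [map_sub, AlgHom.commutes] at this

lemma IsFilteredLimit.add {x x' : AdicCompletion m B} {y y' : E} (h : IsFilteredLimit J φ x y)
    (h' : IsFilteredLimit J φ x' y') : IsFilteredLimit J φ (x + x') (y + y') := by
  intro n b hb
  obtain ⟨c, hc⟩ := exists_mk_eq_evalₐ x n
  obtain ⟨c', hc'⟩ := exists_mk_eq_evalₐ x' n
  rw [map_add, ← hc, ← hc', ← map_add, eq_comm, Ideal.Quotient.eq] at hb
  have := add_mem (add_mem (h n c hc) (h' n c' hc')) (hpow n _ hb)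
  rw [map_sub, map_add] at this
  convert this using 1
  ring

lemma IsFilteredLimit.mul {x x' : AdicCompletion m B} {y y' : E} (h : IsFilteredLimit J φ x y)
    (h' : IsFilteredLimit J φ x' y') : IsFilteredLimit J φ (x * x') (y * y') := by
  intro n b hb
  obtain ⟨c, hc⟩ := exists_mk_eq_evalₐ x n
  obtain ⟨c', hc'⟩ := exists_mk_eq_evalₐ x' n
  rw [map_mul, ← hc, ← hc', ← map_mul, eq_comm, Ideal.Quotient.eq] at hb
  have := add_mem (add_mem ((J n).mul_mem_right y' (h n c hc))
    ((J n).mul_mem_left (φ c) (h' n c' hc'))) (hpow n _ hb)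
  rw [map_sub, map_mul] at this
  convert this using 1
  ring

/-- The `m`-adic completion of `B` is isomorphic to a complete separated filtered algebra `E` in
which `B` is dense, if the filtration induces the `m`-adic topology on `B`. -/
theorem nonempty_adicCompletion_algEquiv (hanti : Antitone J)
    (hcof : ∀ n, ∃ l, ∀ b, φ b ∈ J l → b ∈ m ^ n)
    (hdense : ∀ y l, ∃ b, y - φ b ∈ J l) (hsep : ∀ y, (∀ n, y ∈ J n) → y = 0)
    (hcomp : ∀ y : ℕ → E, (∀ n, y (n + 1) - y n ∈ J n) → ∃ z, ∀ n, z - y n ∈ J n) :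
    Nonempty (AdicCompletion m B ≃ₐ[k] E) := by
  have hex : ∀ x : AdicCompletion m B, ∃ y, IsFilteredLimit J φ x y := by
    intro x
    choose b hb using exists_mk_eq_evalₐ x
    obtain ⟨z, hz⟩ := hcomp (fun n => φ (b n)) fun n => by
      have := (mk_eq_evalₐ_of_le n.le_succ (hb (n + 1))).trans (hb n).symm
      rw [← map_sub]
      exact hpow n _ (Ideal.Quotient.eq.mp this)
    refine ⟨z, fun n c hc => ?_⟩
    have := add_mem (hz n) (hpow n _ (Ideal.Quotient.eq.mp ((hb n).trans hc.symm)))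
    rwa [map_sub, sub_add_sub_cancel] at this
  have huniq : ∀ (x : AdicCompletion m B) (y y' : E), IsFilteredLimit J φ x y →
      IsFilteredLimit J φ x y' → y = y' := by
    intro x y y' h h'
    refine sub_eq_zero.mp (hsep _ fun n => ?_)
    obtain ⟨b, hb⟩ := exists_mk_eq_evalₐ x n
    have := sub_mem (h n b hb) (h' n b hb)
    rwa [sub_sub_sub_cancel_right] at this
  choose ψ hψ using hex
  have halg : ∀ r, ψ (algebraMap k _ r) = algebraMap k E r := fun r =>
    huniq _ _ _ (hψ _) (isFilteredLimit_algebraMap hpow r)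
  have hadd : ∀ x x', ψ (x + x') = ψ x + ψ x' := fun x x' =>
    huniq _ _ _ (hψ _) ((hψ x).add hpow (hψ x'))
  let Ψ : AdicCompletion m B →ₐ[k] E :=
    { toFun := ψ
      map_one' := by simpa using halg 1
      map_mul' := fun x x' => huniq _ _ _ (hψ _) ((hψ x).mul hpow (hψ x'))
      map_zero' := by simpa using halg 0
      map_add' := hadd
      commutes' := halg }
  refine ⟨AlgEquiv.ofBijective Ψ ⟨(injective_iff_map_eq_zero Ψ).mpr fun x hx => ?_, fun y => ?_⟩⟩
  · refine AdicCompletion.ext_evalₐ fun n => ?_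
    obtain ⟨l, hl⟩ := hcof n
    obtain ⟨b, hb⟩ := exists_mk_eq_evalₐ x (max l n)
    have h1 := hanti (le_max_left l n) (hψ x _ b hb)
    rw [show ψ x = 0 from hx, zero_sub, neg_mem_iff] at h1
    rw [← mk_eq_evalₐ_of_le (le_max_right l n) hb, map_zero]
    exact Ideal.Quotient.eq_zero_iff_mem.mpr (hl b h1)
  · choose l hl using hcof
    -- A cofinal sequence of indices, on which the approximations of `y` form a Cauchy sequence.
    let N : ℕ → ℕ := fun n => n + ∑ i ∈ Finset.range (n + 1), l i
    have hlN : ∀ i n, i ≤ n → l i ≤ N n := fun i n hin =>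
      (Finset.single_le_sum (fun _ _ => Nat.zero_le _)
        (Finset.mem_range.mpr (Nat.lt_succ_of_le hin))).trans (Nat.le_add_left _ _)
    choose b hb using fun n => hdense y (N n)
    have hcauchy : ∀ i n n', i ≤ n → i ≤ n' → b n - b n' ∈ m ^ i := by
      intro i n n' hn hn'
      refine hl i _ ?_
      have := sub_mem (hanti (hlN i n' hn') (hb n')) (hanti (hlN i n hn) (hb n))
      rwa [sub_sub_sub_cancel_left, ← map_sub] at this
    let c : AdicCompletion.AdicCauchySequence m B := AdicCompletion.AdicCauchySequence.mk m B b
      fun n => SModEq.sub_mem.mpr (by simpa using hcauchy n n (n + 1) le_rfl n.le_succ)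
    refine ⟨AdicCompletion.mk m B c, huniq (AdicCompletion.mk m B c) _ _ (hψ _) fun n a ha => ?_⟩
    rw [AdicCompletion.evalₐ_mk, eq_comm, Ideal.Quotient.eq] at ha
    have h2 := add_mem (hanti (Nat.le_add_right n _) (hb n)) (hpow n _ ha)
    rwa [map_sub, show c.val n = b n from rfl, sub_add_sub_cancel] at h2

end

/-- The completed local ring at the point of a prime ideal, in terms of a map to a complete
filtered algebra in which the elements outside the prime become invertible. -/
theorem nonempty_completedLocalRing_algEquiv {k A E : Type*} [CommRing k] [CommRing A] [CommRing E]
    [Algebra k A] [Algebra k E] {x : PrimeSpectrum A} {J : ℕ → Ideal E} {φ : A →ₐ[k] E}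
    (hunit : ∀ a ∉ x.asIdeal, IsUnit (φ a)) (hpow : ∀ n, ∀ a ∈ x.asIdeal ^ n, φ a ∈ J n)
    (hanti : Antitone J) (hcof : ∀ n, ∃ l, ∀ a, φ a ∈ J l → a ∈ x.asIdeal ^ n)
    (hdense : ∀ y l, ∃ a, y - φ a ∈ J l) (hsep : ∀ y, (∀ n, y ∈ J n) → y = 0)
    (hcomp : ∀ y : ℕ → E, (∀ n, y (n + 1) - y n ∈ J n) → ∃ z, ∀ n, z - y n ∈ J n) :
    Nonempty (CompletedLocalRing A x ≃ₐ[k] E) := by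
  let B := Localization.AtPrime x.asIdeal
  have hmap : IsLocalRing.maximalIdeal B = x.asIdeal.map (algebraMap A B) :=
    (IsLocalization.AtPrime.map_eq_maximalIdeal x.asIdeal B).symm
  let φ' : B →ₐ[k] E := IsLocalization.liftAlgHom (M := x.asIdeal.primeCompl) (f := φ)
    fun s => hunit s.1 s.2
  have hφ' : ∀ a, φ' (algebraMap A B a) = φ a := fun a => IsLocalization.lift_eq _ a
  refine nonempty_adicCompletion_algEquiv (φ := φ') (J := J) (fun n => ?_) hanti (fun n => ?_)
    (fun y l => ?_) hsep hcomp
  · rw [hmap, ← Ideal.map_pow]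
    have : (x.asIdeal ^ n).map (algebraMap A B) ≤ (J n).comap φ' :=
      Ideal.map_le_iff_le_comap.mpr fun a ha => by
        change φ' (algebraMap A B a) ∈ J n
        rw [hφ']
        exact hpow n a ha
    exact fun b hb => this hb
  · obtain ⟨l, hl⟩ := hcof n
    refine ⟨l, fun b hb => ?_⟩
    obtain ⟨⟨a, s⟩, has⟩ := IsLocalization.surj x.asIdeal.primeCompl b
    have hs : IsUnit (algebraMap A B s) := IsLocalization.map_units B s
    have ha : a ∈ x.asIdeal ^ n := by
      refine hl a ?_
      rw [← hφ', ← has, map_mul]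
      exact (J l).mul_mem_right _ hb
    rw [← Ideal.mul_unit_mem_iff_mem _ hs, has, hmap, ← Ideal.map_pow]
    exact Ideal.mem_map_of_mem _ ha
  · obtain ⟨a, ha⟩ := hdense y l
    exact ⟨algebraMap A B a, by rwa [hφ']⟩

/-! ### Invariant power series -/

open MvPowerSeries

lemma le_order_seriesAct (g : GL (Fin 2) ℂ) (f : MvPowerSeries (Fin 2) ℂ) :
    f.order ≤ (seriesAct g f).order := by
  have h1 : (1 : ℕ∞) ≤ ⨅ i, (∑ j, C ((g⁻¹).1 i j) * X j : MvPowerSeries (Fin 2) ℂ).order :=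
    le_iInf fun i => one_le_order_iff_constCoeff_eq_zero.mpr (by simp)
  calc f.order = 1 * f.order := (one_mul _).symm
    _ ≤ _ := mul_le_mul_left h1 _
    _ ≤ _ := le_order_subst (hasSubst_linear (g⁻¹).1) f
    _ = _ := by rw [seriesAct, coe_substAlgHom]

lemma seriesAct_coe (g : GL (Fin 2) ℂ) (p : MvPolynomial (Fin 2) ℂ) :
    seriesAct g (p : MvPowerSeries (Fin 2) ℂ) = (polyAct g p : MvPolynomial (Fin 2) ℂ) := by
  rw [seriesAct, substAlgHom_coe]
  suffices MvPolynomial.aeval (fun i => ∑ j, C ((g⁻¹).1 i j) * X j :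
      Fin 2 → MvPowerSeries (Fin 2) ℂ) =
      (MvPolynomial.coeToMvPowerSeries.algHom ℂ).comp (polyAct g) by
    rw [this]
    simp [MvPolynomial.coeToMvPowerSeries.algHom_apply]
  refine MvPolynomial.algHom_ext fun i => ?_
  simp [MvPolynomial.coeToMvPowerSeries.algHom_apply, polyAct_X]

/-- The power series of order at least `n`. -/
def orderIdeal (n : ℕ) : Ideal (MvPowerSeries (Fin 2) ℂ) where
  carrier := {f | n ≤ f.order}
  zero_mem' := by simp
  add_mem' hf hg := (le_min hf hg).trans min_order_le_add
  smul_mem' c _ hf := (le_add_left hf).trans le_order_mul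

lemma mem_orderIdeal {n : ℕ} {f : MvPowerSeries (Fin 2) ℂ} : f ∈ orderIdeal n ↔ n ≤ f.order :=
  Iff.rfl

lemma mem_orderIdeal_iff_coeff {n : ℕ} {f : MvPowerSeries (Fin 2) ℂ} :
    f ∈ orderIdeal n ↔ ∀ d : Fin 2 →₀ ℕ, d.degree < n → coeff d f = 0 :=
  ⟨fun h _ hd => coeff_of_lt_order (lt_of_lt_of_le (by exact_mod_cast hd) h), nat_le_order⟩

lemma orderIdeal_antitone : Antitone orderIdeal := fun _ _ h _ hf =>
  le_trans (by exact_mod_cast h) (mem_orderIdeal.mp hf)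

lemma orderIdeal_one_pow_le (n : ℕ) : orderIdeal 1 ^ n ≤ orderIdeal n := by
  induction n with
  | zero => exact fun f _ => mem_orderIdeal.mpr (by simp)
  | succ n ih =>
    rw [pow_succ]
    refine Ideal.mul_le.mpr fun f hf g hg => ?_
    have h1 := mem_orderIdeal.mp (ih hf)
    have h2 := mem_orderIdeal.mp hg
    rw [mem_orderIdeal, Nat.cast_add]
    exact (add_le_add h1 h2).trans le_order_mul

lemma eq_zero_of_forall_mem_orderIdeal {f : MvPowerSeries (Fin 2) ℂ}
    (h : ∀ n, f ∈ orderIdeal n) : f = 0 := by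
  ext d
  rw [mem_orderIdeal_iff_coeff.mp (h (d.degree + 1)) d (Nat.lt_succ_self _), coeff_zero]

lemma sub_truncTotal_mem_orderIdeal (f : MvPowerSeries (Fin 2) ℂ) (n : ℕ) :
    f - (truncTotal n f : MvPolynomial (Fin 2) ℂ) ∈ orderIdeal n :=
  mem_orderIdeal_iff_coeff.mpr fun d hd => by
    rw [map_sub, MvPolynomial.coeff_coe, coeff_truncTotal _ hd, sub_self]

lemma seriesAct_mem_orderIdeal {n : ℕ} {f : MvPowerSeries (Fin 2) ℂ} (hf : f ∈ orderIdeal n)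
    (g : GL (Fin 2) ℂ) : seriesAct g f ∈ orderIdeal n :=
  (mem_orderIdeal.mp hf).trans (le_order_seriesAct g f)

section

variable {H : Subgroup (GL (Fin 2) ℂ)}

/-- A truncation of an invariant series is invariant, because a linear change of the variables
preserves both the degree of polynomials and the order of series. -/
lemma truncTotal_mem_polyInvariants {f : MvPowerSeries (Fin 2) ℂ} (hf : f ∈ seriesInvariants H)
    (n : ℕ) : truncTotal n f ∈ polyInvariants H := by
  refine mem_polyInvariants.mpr fun g hg => ?_
  have h1 := sub_truncTotal_mem_orderIdeal f n
  have h2 := sub_mem h1 (seriesAct_mem_orderIdeal h1 g)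
  rw [map_sub, hf g hg, sub_sub_sub_cancel_left, seriesAct_coe] at h2
  rw [← sub_eq_zero]
  ext d
  rw [MvPolynomial.coeff_zero]
  rcases lt_or_ge d.degree n with hd | hd
  · have := mem_orderIdeal_iff_coeff.mp h2 d hd
    rwa [map_sub, MvPolynomial.coeff_coe, MvPolynomial.coeff_coe, ← MvPolynomial.coeff_sub] at this
  · rw [MvPolynomial.coeff_sub, coeff_truncTotal_eq_zero _ hd, sub_zero]
    rcases Nat.eq_zero_or_pos n with rfl | hn
    · have h0 : truncTotal 0 f = 0 := by
        ext e
        rw [coeff_truncTotal_eq_zero _ (Nat.zero_le _), MvPolynomial.coeff_zero]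
      rw [h0, map_zero, MvPolynomial.coeff_zero]
    · refine MvPolynomial.coeff_eq_zero_of_totalDegree_lt ?_
      exact ((totalDegree_polyAct_le g _).trans_lt (totalDegree_truncTotal_lt _ hn.ne')).trans_le hd

/-- Invariant polynomials as invariant power series. -/
def polyInvariantsToSeries (H : Subgroup (GL (Fin 2) ℂ)) :
    polyInvariants H →ₐ[ℂ] seriesInvariants H :=
  ((MvPolynomial.coeToMvPowerSeries.algHom ℂ).comp (polyInvariants H).val).codRestrict _
    fun b g hg => by
      simp [MvPolynomial.coeToMvPowerSeries.algHom_apply, seriesAct_coe, b.2 g hg]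

lemma coe_polyInvariantsToSeries (b : polyInvariants H) :
    (polyInvariantsToSeries H b : MvPowerSeries (Fin 2) ℂ) = (b.1 : MvPolynomial (Fin 2) ℂ) := by
  change MvPolynomial.coeToMvPowerSeries.algHom ℂ b.1 = _
  simp [MvPolynomial.coeToMvPowerSeries.algHom_apply]

/-- The inverse of an invariant series is invariant. -/
lemma isUnit_of_constantCoeff_ne_zero {f : seriesInvariants H} (hf : constantCoeff f.1 ≠ 0) :
    IsUnit f := by
  have hinv : f.1 * f.1⁻¹ = 1 := MvPowerSeries.mul_inv_cancel _ hf
  refine IsUnit.of_mul_eq_one ⟨f.1⁻¹, fun g hg => ?_⟩ (Subtype.ext hinv)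
  have h1 := congrArg (seriesAct g) hinv
  rw [map_mul, map_one, f.2 g hg, ← hinv] at h1
  exact mul_left_cancel₀ (fun h => hf (by rw [h, map_zero])) h1

/-- The completed local ring of `Spec ℂ[V]^H` at the origin is `ℂ⟦t, u⟧^H`. The algebra is given up
to isomorphism only, so that other coordinates may be used on it. The powers of the maximal ideal
define the same topology as the degree, because the generators of the invariants have bounded
degree. -/
theorem nonempty_completedLocalRing_algEquiv_seriesInvariants [Finite H] {A : Type*} [CommRing A]
    [Algebra ℂ A] (e : A ≃ₐ[ℂ] polyInvariants H) {x : PrimeSpectrum A}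
    (hx : ∀ a, a ∈ x.asIdeal ↔ MvPolynomial.constantCoeff (e a).1 = 0) :
    Nonempty (CompletedLocalRing A x ≃ₐ[ℂ] seriesInvariants H) := by
  let incl : seriesInvariants H →+* MvPowerSeries (Fin 2) ℂ :=
    (seriesInvariants H).val.toRingHom
  let φ : A →ₐ[ℂ] seriesInvariants H := (polyInvariantsToSeries H).comp e.toAlgHom
  have hφ : ∀ a, (φ a).1 = ((e a).1 : MvPolynomial (Fin 2) ℂ) := fun a =>
    coe_polyInvariantsToSeries (e a)
  refine nonempty_completedLocalRing_algEquiv (J := fun n => (orderIdeal n).comap incl) (φ := φ)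
    ?_ ?_ (fun _ _ h => Ideal.comap_mono (orderIdeal_antitone h)) ?_ ?_ ?_ ?_
  · intro a ha
    refine isUnit_of_constantCoeff_ne_zero ?_
    rw [hx] at ha
    rwa [hφ, ← coeff_zero_eq_constantCoeff_apply, MvPolynomial.coeff_coe,
      ← MvPolynomial.constantCoeff_eq]
  · intro n
    have h1 : x.asIdeal ≤ ((orderIdeal 1).comap incl).comap φ := by
      intro a ha
      change (φ a).1 ∈ orderIdeal 1
      rw [hx] at ha
      rw [hφ, mem_orderIdeal, Nat.cast_one, one_le_order_iff_constCoeff_eq_zero,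
        ← coeff_zero_eq_constantCoeff_apply, MvPolynomial.coeff_coe,
        ← MvPolynomial.constantCoeff_eq, ha]
    intro a ha
    have h2 := Ideal.le_comap_pow φ n (Ideal.pow_right_mono h1 n ha)
    exact Ideal.comap_mono (orderIdeal_one_pow_le n) (Ideal.le_comap_pow incl n h2)
  · intro n
    obtain ⟨t, d, ht, -⟩ := exists_isHilbertSystem H
    set D := Finset.univ.sup d + 1 with hD
    have hdD : ∀ i, d i ≤ D := fun i => (Finset.le_sup (Finset.mem_univ i)).trans (Nat.le_succ _)
    have hsymm : (quotientMap H 0).asIdeal ≤ x.asIdeal.comap e.symm := by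
      intro b hb
      rw [mem_quotientMap_zero] at hb
      rw [Ideal.mem_comap, hx]
      simpa using hb
    refine ⟨n * D, fun a ha => ?_⟩
    have ha' : ∀ m : Fin 2 →₀ ℕ, m.degree < n * D → (e a).1.coeff m = 0 := by
      intro m hm
      have h1 : (φ a).1 ∈ orderIdeal (n * D) := ha
      rw [hφ] at h1
      have h2 := mem_orderIdeal_iff_coeff.mp h1 m hm
      rwa [MvPolynomial.coeff_coe] at h2
    have hmem : e a ∈ (quotientMap H 0).asIdeal ^ n := by
      have hsum : e a = ∑ i ∈ Finset.range ((e a).1.totalDegree + 1),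
          (⟨_, homogeneousComponent_mem_polyInvariants (e a).2 i⟩ : polyInvariants H) := by
        ext1
        rw [AddSubmonoidClass.coe_finsetSum, MvPolynomial.sum_homogeneousComponent]
      rw [hsum]
      refine Ideal.sum_mem _ fun i _ => ?_
      rcases lt_or_ge i (n * D) with hi | hi
      · convert zero_mem ((quotientMap H 0).asIdeal ^ n)
        ext m
        rw [MvPolynomial.coeff_homogeneousComponent, ZeroMemClass.coe_zero, MvPolynomial.coeff_zero]
        split_ifs with hm
        · exact ha' m (hm ▸ hi)
        · rfl
      · exact ht.mem_pow_of_isHomogeneous hdD (Nat.succ_pos _) n _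
          (MvPolynomial.homogeneousComponent_isHomogeneous i _) hi
    have h3 := Ideal.le_comap_pow e.symm n (Ideal.pow_right_mono hsymm n hmem)
    rwa [Ideal.mem_comap, AlgEquiv.symm_apply_apply] at h3
  · intro y l
    refine ⟨e.symm ⟨_, truncTotal_mem_polyInvariants y.2 l⟩, ?_⟩
    change y.1 - (φ _).1 ∈ orderIdeal l
    rw [hφ, AlgEquiv.apply_symm_apply]
    exact sub_truncTotal_mem_orderIdeal y.1 l
  · intro y hy
    exact Subtype.ext (eq_zero_of_forall_mem_orderIdeal hy)
  · intro y hy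
    have hy' : ∀ n, (y (n + 1)).1 - (y n).1 ∈ orderIdeal n := hy
    -- The coefficients of degree `n` of the sequence are constant from the index `n + 1` on.
    let z : MvPowerSeries (Fin 2) ℂ := fun m => coeff m (y (m.degree + 1)).1
    have hcoeff : ∀ m, coeff m z = coeff m (y (m.degree + 1)).1 := fun _ => rfl
    have hz : ∀ n, z - (y n).1 ∈ orderIdeal n := by
      refine fun n => mem_orderIdeal_iff_coeff.mpr fun m hm => ?_
      rw [map_sub, sub_eq_zero, hcoeff]
      induction n, Nat.succ_le_of_lt hm using Nat.le_induction with
      | base => rfl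
      | succ n hn ih =>
        have := mem_orderIdeal_iff_coeff.mp (hy' n) m hn
        rw [map_sub, sub_eq_zero] at this
        rw [this, ih hn]
    refine ⟨⟨z, fun g hg => sub_eq_zero.mp (eq_zero_of_forall_mem_orderIdeal fun n => ?_)⟩, hz⟩
    have := sub_mem (seriesAct_mem_orderIdeal (hz n) g) (hz n)
    rwa [map_sub, (y n).2 g hg, sub_sub_sub_cancel_right] at this

end

end

end PlaneQuotient

/-! ### The singularity at the origin -/

namespace PlaneQuotient

open MvPolynomial

noncomputable section

/-- If two members of a Hilbert system generate the invariants of `Γ`, then `V/Γ` is a plane. -/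
lemma isSmoothPoint_of_isHilbertSystem {Γ : Subgroup (GL (Fin 2) ℂ)} [Finite Γ]
    {f : Fin 2 → MvPolynomial (Fin 2) ℂ} {d : Fin 2 → ℕ} (hf : IsHilbertSystem Γ f d)
    (x : PrimeSpectrum (polyInvariants Γ)) : IsSmoothPoint (polyInvariants Γ) x := by
  have e : MvPolynomial (Fin 2) ℂ ≃ₐ[ℂ] polyInvariants Γ :=
    hf.algebraicIndependent_fin_two.aevalEquiv.trans (Subalgebra.equivOfEq _ _ hf.adjoin_eq)
  have : Algebra.Smooth ℂ (MvPolynomial (Fin 2) ℂ) := {}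
  have : Algebra.Smooth ℂ (polyInvariants Γ) := Algebra.Smooth.of_equiv e
  rw [IsSmoothPoint, Algebra.smoothLocus_eq_univ]
  exact Set.mem_univ x

lemma constantCoeff_aeval {f : Fin 2 → MvPolynomial (Fin 2) ℂ}
    (hf : ∀ i, constantCoeff (f i) = 0) (p : MvPolynomial (Fin 2) ℂ) :
    constantCoeff (aeval (R := ℂ) f p) = constantCoeff p := by
  induction p using MvPolynomial.induction_on with
  | C a => simp
  | add p q hp hq => simp only [map_add, hp, hq]
  | mul_X p i hp => simp only [map_mul, aeval_X, hf, mul_zero, constantCoeff_X]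

section

variable {R G Γ : Subgroup (GL (Fin 2) ℂ)} [Finite R]
  {f : Fin 2 → MvPolynomial (Fin 2) ℂ} {d : Fin 2 → ℕ} {ρ : G →* GL (Fin 2) ℂ}

/-- In the coordinates `f` on `V/R`, the invariants of `Γ` are the invariants of the linear group
`ρ(Γ)`. -/
lemma IsHilbertSystem.aeval_mem_polyInvariants_iff (hf : IsHilbertSystem R f d) (hΓ : Γ ≤ G)
    (hρ : ∀ g p, aeval f (polyAct (ρ g) p) = polyAct g.1 (aeval f p))
    (p : MvPolynomial (Fin 2) ℂ) :
    aeval f p ∈ polyInvariants Γ ↔ p ∈ polyInvariants ((Γ.subgroupOf G).map ρ) := by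
  have hinj : Function.Injective (aeval (R := ℂ) f) := hf.algebraicIndependent_fin_two
  constructor
  · rintro h _ ⟨g, hg, rfl⟩
    apply hinj
    rw [hρ]
    exact h g.1 hg
  · intro h g hg
    rw [← hρ ⟨g, hΓ hg⟩, h _ ⟨⟨g, hΓ hg⟩, hg, rfl⟩]

/-- The isomorphism `ℂ[V/R]^{ρ(Γ)} ≃ ℂ[V]^Γ`. -/
def IsHilbertSystem.polyInvariantsEquiv (hf : IsHilbertSystem R f d) (hΓ : Γ ≤ G) (hR : R ≤ Γ)
    (hρ : ∀ g p, aeval f (polyAct (ρ g) p) = polyAct g.1 (aeval f p)) :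
    polyInvariants ((Γ.subgroupOf G).map ρ) ≃ₐ[ℂ] polyInvariants Γ :=
  AlgEquiv.ofBijective
    (((aeval (R := ℂ) f).comp (polyInvariants ((Γ.subgroupOf G).map ρ)).val).codRestrict _
      fun p => (hf.aeval_mem_polyInvariants_iff hΓ hρ p.1).mpr p.2)
    ⟨fun p q h => Subtype.ext (hf.algebraicIndependent_fin_two (congrArg Subtype.val h)),
      fun b => by
        obtain ⟨p, hp⟩ := hf.exists_aeval_eq (b := b.1) fun r hr => b.2 r (hR hr)
        exact ⟨⟨p, (hf.aeval_mem_polyInvariants_iff hΓ hρ p).mp (hp ▸ b.2)⟩, Subtype.ext hp⟩⟩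

lemma IsHilbertSystem.coe_polyInvariantsEquiv (hf : IsHilbertSystem R f d) (hΓ : Γ ≤ G)
    (hR : R ≤ Γ) (hρ : ∀ g p, aeval f (polyAct (ρ g) p) = polyAct g.1 (aeval f p))
    (p : polyInvariants ((Γ.subgroupOf G).map ρ)) :
    (hf.polyInvariantsEquiv hΓ hR hρ p).1 = aeval f p.1 := rfl

end

/-- If `Γ` is not generated by its reflections and has index two in a reflection group, the origin
is an ADE singularity: the group `ρ(Γ) ⊆ SL₂(ℂ)` acting on the plane `V/R` is nontrivial. -/
theorem isADESingularity_of_closure_reflections_ne {G Γ : Subgroup (GL (Fin 2) ℂ)} [Finite G]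
    (hG : Subgroup.closure (reflections G) = G) (hΓ : Γ ≤ G) (hindex : Γ.relIndex G = 2)
    (hne : Subgroup.closure (reflections Γ) ≠ Γ) :
    IsADESingularity (polyInvariants Γ) (quotientMap Γ 0) := by
  have hRΓ := closure_reflections_le Γ
  have : Finite (Subgroup.closure (reflections Γ)) :=
    Finite.of_injective _ (Subgroup.inclusion_injective (hRΓ.trans hΓ))
  have hconj : ∀ g ∈ G, ∀ r ∈ Γ, g⁻¹ * r * g⁻¹⁻¹ ∈ Γ := by
    intro g hg r hr
    have := Subgroup.normal_of_index_eq_two (H := Γ.subgroupOf G) hindex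
    exact this.conj_mem ⟨r, hΓ hr⟩ hr ⟨g, hg⟩⁻¹
  obtain ⟨f, d, hf, hequi⟩ := exists_isHilbertSystem_equivariant
    (closure_reflections_closure_reflections Γ) (G := G) fun g hg r hr => by
      have := conj_mem_closure_reflections (hconj g hg) r hr
      rwa [inv_inv] at this
  obtain ⟨ρ, hρ⟩ := hf.exists_monoidHom hequi
  set K := (Γ.subgroupOf G).map ρ with hK
  have hdet : ∀ m ∈ K, m.1.det = 1 := by
    rintro _ ⟨g, hg, rfl⟩
    exact det_monoidHom_eq_one_of_mem hG hindex hf hρ hg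
  set H : Subgroup (SpecialLinearGroup (Fin 2) ℂ) := K.comap SpecialLinearGroup.toGL with hH
  have hHK : H.map SpecialLinearGroup.toGL = K := by
    rw [hH, Subgroup.map_comap_eq, inf_eq_right]
    exact fun m hm => ⟨⟨m.1, hdet m hm⟩, Units.ext rfl⟩
  have hKfin : Finite K := ((Set.toFinite (Γ.subgroupOf G : Set G)).image ρ).to_subtype
  have htoGL : Function.Injective (SpecialLinearGroup.toGL (n := Fin 2) (R := ℂ)) :=
    fun a b h => Subtype.ext (congrArg Units.val h)
  refine ⟨H, ?_, fun hbot => hne ?_, ?_⟩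
  · exact Finite.of_injective (fun h : H => (⟨SpecialLinearGroup.toGL h.1, h.2⟩ : K))
      fun a b h => Subtype.ext (htoGL (congrArg Subtype.val h))
  · refine le_antisymm hRΓ fun g hg => ?_
    have h1 : ρ ⟨g, hΓ hg⟩ ∈ K := ⟨⟨g, hΓ hg⟩, hg, rfl⟩
    rw [← hHK, hbot, Subgroup.map_bot, Subgroup.mem_bot] at h1
    exact (hf.monoidHom_eq_one_iff hρ _).mp h1
  · rw [hHK]
    refine nonempty_completedLocalRing_algEquiv_seriesInvariants
      (hf.polyInvariantsEquiv hΓ hRΓ hρ).symm fun b => ?_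
    obtain ⟨p, rfl⟩ := (hf.polyInvariantsEquiv hΓ hRΓ hρ).surjective b
    rw [AlgEquiv.symm_apply_apply, mem_quotientMap_zero, hf.coe_polyInvariantsEquiv,
      constantCoeff_aeval fun i => constantCoeff_eq_zero_of_isHomogeneous (hf.pos i)
        (hf.homogeneous i)]

end

end PlaneQuotient

theorem mainTheorem6 (G Γ : Subgroup (GL (Fin 2) ℂ)) (hfin : Finite G)
    (hG : Subgroup.closure (PlaneQuotient.reflections G) = G)
    (hΓ : Γ ≤ G) (hindex : Γ.relIndex G = 1 ∨ Γ.relIndex G = 2) :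
    PlaneQuotient.IsSmoothPoint (PlaneQuotient.polyInvariants Γ)
        (PlaneQuotient.quotientMap Γ 0) ∨
      PlaneQuotient.IsADESingularity (PlaneQuotient.polyInvariants Γ)
        (PlaneQuotient.quotientMap Γ 0) := by
  have hΓfin : Finite Γ := Finite.of_injective _ (Subgroup.inclusion_injective hΓ)
  by_cases hR : Subgroup.closure (PlaneQuotient.reflections Γ) = Γ
  · left
    obtain ⟨f, d, hf, -⟩ := PlaneQuotient.exists_isHilbertSystem_fin_two hR
    exact PlaneQuotient.isSmoothPoint_of_isHilbertSystem hf _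
  · right
    refine PlaneQuotient.isADESingularity_of_closure_reflections_ne hG hΓ
      (hindex.resolve_left fun h1 => hR ?_) hR
    rw [le_antisymm hΓ (Subgroup.relIndex_eq_one.mp h1), hG]
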